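/- Let $n\ge 1$ and let $\mathcal G$ be a compact star graph with central vertex $v$ and edges $e_j=[v,v_j]$ of finite positive lengths, $j=1,\dots,n$. Let $p_j,q_j\in L^1(e_j,\mathbb R)$, $\alpha_j\in[0,\pi)$, and put $$J=\begin{pmatrix}0&-1\\1&0\end{pmatrix},\qquad V_j=\begin{pmatrix}p_j&q_j\\q_j&-p_j\end{pmatrix},\qquad H_j=-J\frac{d}{dx}+V_j .$$ For $\tau\in\mathbb R\cup\{\pm\infty\}$ let $\mathcal T_\tau$ be the operator in $\bigoplus_{j=1}^n\big(L^2(e_j)\oplus L^2(e_j)\big)$ that acts as $(\boldsymbol f_j)_1^n\mapsto(H_j\boldsymbol f_j)_1^n$ on the domain of all $\boldsymbol f=(\boldsymbol f_j)_1^n$, $\boldsymbol f_j=(f_j,\widehat f_j)^{\mathrm t}$, such that every $\boldsymbol f_j$ is absolutely continuous, $H_j\boldsymbol f_j\in L^2(e_j)\oplus L^2(e_j)$, $\cos\alpha_j\,f_j(v_j)+\sin\alpha_j\,\widehat f_j(v_j)=0$, and $$f_1(v)=\dots=f_n(v),\qquad f_1(v)=\tau\big(\widehat f_1(v)+\dots+\widehat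 f_n(v)\big);$$ for $\tau=\pm\infty$ the last equation is read as $\widehat f_1(v)+\dots+\widehat f_n(v)=0$. The multiplicity of an eigenvalue $z$ is $\dim\ker(\mathcal T_\tau-z)$. Let $Y_j(\cdot,z)=(y_{j,kl}(\cdot,z))_{k,l=1}^2$ be the solution of $-JY_j'+V_jY_j=zY_j$ on $e_j$ with $Y_j(v,z)=I_2$, and let $$m_j(z)=\frac{y_{j,11}(v_j,z)\cos\alpha_j+y_{j,21}(v_j,z)\sin\alpha_j}{y_{j,12}(v_j,z)\cos\alpha_j+y_{j,22}(v_j,z)\sin\alpha_j}$$ be the Weyl–Titchmarsh function of $e_j$, a meromorphic function on $\mathbb C$. A solution of the equation $$\sum_{j=1}^n m_j(z)=-\frac1\tau \qquad\Big(\frac1{\pm\infty}:=0\Big)\tag{1}$$ is a $z\in\mathbb C$ that is not a pole of any $m_j$ and satisfies (1). **Theorem.** For $\tau\in(\mathbb R\cup\{\pm\infty\})\setminus\{0\}$, a number $z\in\mathbb C$ is an eigenvalue of $\mathcal T_\tau$ if and only if it is a solution of (1) or a common pole of at least two of the functions $m_1,\dots,m_n$. Moreover: i) Every solution of (1) is a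 simple eigenvalue of $\mathcal T_\tau$. It is a strictly increasing function of $\tau$ on each of the intervals $I=[-\infty,0)$ and $I=(0,\infty]$: for $\tau_0\in I$ and every solution $z_0$ of (1) with $\tau=\tau_0$, there is exactly one continuous function $\lambda:I\to\mathbb R$ with $\lambda(\tau_0)=z_0$ such that $\lambda(\tau)$ is a solution of (1) for all $\tau\in I$, and this function $\lambda$ is strictly increasing. ii) If $\nu\ge1$ and $z$ is a pole of exactly $\nu+1$ of the functions $m_1,\dots,m_n$, then, for all $\tau\ne0$, $z$ is an eigenvalue of $\mathcal T_\tau$ of multiplicity $\nu$ (so these eigenvalues and their multiplicities do not depend on $\tau$). Further, for any $\tau_1,\tau_2\in\mathbb R\cup\{\pm\infty\}$ (the value $0$ is allowed), the eigenvalues of $\mathcal T_{\tau_1}$ and $\mathcal T_{\tau_2}$ interlace: all eigenvalues of $\mathcal T_{\tau_1}$ and of $\mathcal T_{\tau_2}$ are real and, counted with multiplicities, they can be listed as nondecreasing sequences $(a_k)_{k\in\mathbb Z}$ and $(b_k)_{k\in\mathbb Z}$, respectively, such that $a_k\le b_k\le a_{k+1}$ for all $k\in\mathbb Z$. -/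

import Mathlib

open MeasureTheory Set Matrix

noncomputable section

/-- A compact star graph with edges `e_j = [0, ℓ_j]`, `j : Fin n` (the central vertex is `0` on each
edge, the outer vertex `v_j` is `ℓ_j`), real potentials `p_j, q_j ∈ L¹(e_j)` and boundary parameters
`α_j ∈ [0, π)` at the outer vertices. -/
structure DiracStarGraph (n : ℕ) where
  ℓ : Fin n → ℝ
  p : Fin n → ℝ → ℝ
  q : Fin n → ℝ → ℝ
  α : Fin n → ℝ
  ℓ_pos : ∀ j, 0 < ℓ j
  p_integrable : ∀ j, IntegrableOn (p j) (Icc 0 (ℓ j))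
  q_integrable : ∀ j, IntegrableOn (q j) (Icc 0 (ℓ j))
  α_mem : ∀ j, α j ∈ Ico 0 Real.pi

namespace DiracStarGraph

variable {n : ℕ} (G : DiracStarGraph n)

/-- Lebesgue measure on the edge `e_j = [0, ℓ_j]`. -/
abbrev μ (j : Fin n) : Measure ℝ := volume.restrict (Icc 0 (G.ℓ j))

/-- The Hilbert space `L²(G) = ⨁_j (L²(e_j) ⊕ L²(e_j))`; the component `u j 0` is `f_j`,
the component `u j 1` is `f̂_j`. -/
abbrev H : Type := PiLp 2 (fun j : Fin n => PiLp 2 (fun _ : Fin 2 => Lp ℂ 2 (G.μ j)))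

/-- The matrix `J`. -/
def J : Matrix (Fin 2) (Fin 2) ℂ := !![0, -1; 1, 0]

/-- The potential matrix `V_j(x)`. -/
def V (j : Fin n) (x : ℝ) : Matrix (Fin 2) (Fin 2) ℂ :=
  !![(G.p j x : ℂ), (G.q j x : ℂ); (G.q j x : ℂ), -(G.p j x : ℂ)]

/-- The Dirac–Krein expression `(-J d/dx + V_j) f` at the point `x`. -/
def diracExpr (j : Fin n) (f : ℝ → Fin 2 → ℂ) (x : ℝ) : Fin 2 → ℂ :=
  -(J *ᵥ deriv f x) + G.V j x *ᵥ f x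

/-- The boundary condition `cos α_j f_j(v_j) + sin α_j f̂_j(v_j) = 0` at the outer vertex. -/
def OuterCondition (j : Fin n) (f : ℝ → Fin 2 → ℂ) : Prop :=
  (Real.cos (G.α j) : ℂ) * f (G.ℓ j) 0 + (Real.sin (G.α j) : ℂ) * f (G.ℓ j) 1 = 0

/-- The Robin matching condition with parameter `τ ∈ [-∞, ∞]` at the central vertex:
`f_1(v) = ⋯ = f_n(v)` and `f_1(v) = τ (f̂_1(v) + ⋯ + f̂_n(v))`, where `τ = ±∞` means
`f̂_1(v) + ⋯ + f̂_n(v) = 0` in the second condition. -/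
def RobinCondition (τ : EReal) (f : Fin n → ℝ → Fin 2 → ℂ) : Prop :=
  (∀ j k, f j 0 0 = f k 0 0) ∧
  ((τ ≠ ⊤ ∧ τ ≠ ⊥) → ∀ j, f j 0 0 = (τ.toReal : ℂ) * ∑ k, f k 0 1) ∧
  ((τ = ⊤ ∨ τ = ⊥) → ∑ k, f k 0 1 = 0)

/-- `w = T_τ u`, with `u` represented by the family `f` of absolutely continuous functions. -/
def IsRobinPair (τ : EReal) (u w : G.H) (f : Fin n → ℝ → Fin 2 → ℂ) : Prop :=
  (∀ j, AbsolutelyContinuousOnInterval (f j) 0 (G.ℓ j)) ∧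
  (∀ j i, (u j i : ℝ → ℂ) =ᵐ[G.μ j] fun x => f j x i) ∧
  (∀ j i, (w j i : ℝ → ℂ) =ᵐ[G.μ j] fun x => G.diracExpr j (f j) x i) ∧
  (∀ j, G.OuterCondition j (f j)) ∧
  RobinCondition τ f

theorem ae_Ioo (j : Fin n) : ∀ᵐ x ∂(G.μ j), x ∈ Ioo 0 (G.ℓ j) := by
  have h : G.μ j = volume.restrict (Ioo 0 (G.ℓ j)) := Measure.restrict_congr_set Ioo_ae_eq_Icc.symm
  rw [h]
  exact ae_restrict_mem measurableSet_Ioo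

/-- Absolutely continuous vector functions are differentiable almost everywhere. -/
theorem ae_differentiableAt (j : Fin n) {f : ℝ → Fin 2 → ℂ}
    (hf : AbsolutelyContinuousOnInterval f 0 (G.ℓ j)) :
    ∀ᵐ x ∂(G.μ j), DifferentiableAt ℝ f x := by
  have key : ∀ (L : (Fin 2 → ℂ) →L[ℝ] ℝ), ∀ᵐ x ∂(G.μ j),
      DifferentiableAt ℝ (fun x => L (f x)) x := by
    intro L
    have h1 : BoundedVariationOn (fun x => L (f x)) (uIcc 0 (G.ℓ j)) :=
      (L.lipschitz.lipschitzOnWith (s := univ)).comp_boundedVariationOn (mapsTo_univ _ _)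
        hf.boundedVariationOn
    have h2 := h1.locallyBoundedVariationOn.ae_differentiableWithinAt_of_mem
    filter_upwards [G.ae_Ioo j, ae_restrict_of_ae h2] with x hx h
    rw [uIcc_of_le (G.ℓ_pos j).le] at h
    exact (h ⟨hx.1.le, hx.2.le⟩).differentiableAt (Icc_mem_nhds hx.1 hx.2)
  have hre : ∀ i : Fin 2, ∀ᵐ x ∂(G.μ j), DifferentiableAt ℝ (fun x => (f x i).re) x := fun i =>
    key (Complex.reCLM.comp (ContinuousLinearMap.proj (R := ℝ) (φ := fun _ : Fin 2 => ℂ) i))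
  have him : ∀ i : Fin 2, ∀ᵐ x ∂(G.μ j), DifferentiableAt ℝ (fun x => (f x i).im) x := fun i =>
    key (Complex.imCLM.comp (ContinuousLinearMap.proj (R := ℝ) (φ := fun _ : Fin 2 => ℂ) i))
  filter_upwards [ae_all_iff.2 hre, ae_all_iff.2 him] with x h1 h2
  refine differentiableAt_pi.2 fun i => ?_
  have h3 : (fun x => f x i) = fun x =>
      Complex.equivRealProdCLM.symm ((f x i).re, (f x i).im) := by
    funext y; apply Complex.ext <;> simp
  rw [h3]
  exact Complex.equivRealProdCLM.symm.differentiableAt.comp x ((h1 i).prodMk (h2 i))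

/-- The graph `{(u, T_τ u)}` of the operator `T_τ`. -/
def robinGraph (τ : EReal) : Submodule ℂ (G.H × G.H) where
  carrier := {u | ∃ f, G.IsRobinPair τ u.1 u.2 f}
  zero_mem' := by
    refine ⟨fun _ _ => 0, fun j => ?_, fun j i => ?_, fun j i => ?_, fun j => ?_, ?_, ?_, ?_⟩
    · exact ((LipschitzWith.const (0 : Fin 2 → ℂ)).lipschitzOnWith).absolutelyContinuousOnInterval
    · exact Lp.coeFn_zero _ _ _
    · filter_upwards [Lp.coeFn_zero ℂ 2 (G.μ j)] with x hx
      simpa [diracExpr] using hx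
    · simp [OuterCondition]
    · simp
    · simp
    · simp
  add_mem' := by
    rintro u v ⟨f, hf1, hf2, hf3, hf4, hf5, hf6, hf7⟩ ⟨g, hg1, hg2, hg3, hg4, hg5, hg6, hg7⟩
    refine ⟨fun j x => f j x + g j x, fun j => ?_, fun j i => ?_, fun j i => ?_, fun j => ?_,
      fun j k => ?_, fun h j => ?_, fun h => ?_⟩
    · exact (hf1 j).add (hg1 j)
    · filter_upwards [hf2 j i, hg2 j i, Lp.coeFn_add (u.1 j i) (v.1 j i)] with x h1 h2 h3
      simpa [h1, h2] using h3
    · filter_upwards [hf3 j i, hg3 j i, Lp.coeFn_add (u.2 j i) (v.2 j i),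
        G.ae_differentiableAt j (hf1 j), G.ae_differentiableAt j (hg1 j)] with x h1 h2 h3 h4 h5
      refine h3.trans ?_
      rw [Pi.add_apply, h1, h2]
      simp only [diracExpr, deriv_fun_add h4 h5, mulVec_add, Pi.add_apply, Pi.neg_apply]
      ring
    · have h1 := hf4 j
      have h2 := hg4 j
      simp only [OuterCondition, Pi.add_apply] at *
      linear_combination h1 + h2
    · simp [hf5 j k, hg5 j k]
    · have h1 := hf6 h j
      have h2 := hg6 h j
      simp only [Pi.add_apply, Finset.sum_add_distrib]
      linear_combination h1 + h2
    · simp [Finset.sum_add_distrib, hf7 h, hg7 h]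
  smul_mem' := by
    rintro c u ⟨f, hf1, hf2, hf3, hf4, hf5, hf6, hf7⟩
    refine ⟨fun j x => c • f j x, fun j => ?_, fun j i => ?_, fun j i => ?_, fun j => ?_,
      fun j k => ?_, fun h j => ?_, fun h => ?_⟩
    · exact (hf1 j).const_smul c
    · filter_upwards [hf2 j i, Lp.coeFn_smul c (u.1 j i)] with x h1 h3
      simpa [h1] using h3
    · filter_upwards [hf3 j i, Lp.coeFn_smul c (u.2 j i),
        G.ae_differentiableAt j (hf1 j)] with x h1 h3 h4
      refine h3.trans ?_
      rw [Pi.smul_apply, h1]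
      simp only [diracExpr, deriv_fun_const_smul c h4, mulVec_smul, Pi.add_apply, Pi.neg_apply,
        Pi.smul_apply, smul_eq_mul]
      ring
    · have h1 := hf4 j
      simp only [OuterCondition, Pi.smul_apply, smul_eq_mul] at *
      linear_combination c * h1
    · simp [hf5 j k]
    · have h1 := hf6 h j
      simp only [Pi.smul_apply, smul_eq_mul, ← Finset.mul_sum]
      linear_combination c * h1
    · simp [← Finset.mul_sum, hf7 h]

theorem robinGraph_single_valued (τ : EReal) (u : G.H × G.H) (hu : u ∈ G.robinGraph τ)
    (h0 : u.1 = 0) : u.2 = 0 := by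
  obtain ⟨f, h1, h2, h3, -⟩ := hu
  ext1 j
  ext1 i
  have hz : ∀ i, (fun x => f j x i) =ᵐ[G.μ j] 0 := by
    intro i
    have h := h2 j i
    rw [h0] at h
    exact h.symm.trans (Lp.coeFn_zero _ _ _)
  have hcont : ContinuousOn (f j) (Icc 0 (G.ℓ j)) := by
    have := (h1 j).continuousOn
    rwa [uIcc_of_le (G.ℓ_pos j).le] at this
  have heq : ∀ i, EqOn (fun x => f j x i) (fun _ => 0) (Icc 0 (G.ℓ j)) := fun i =>
    Measure.eqOn_Icc_of_ae_eq volume (G.ℓ_pos j).ne (hz i)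
      ((continuous_apply i).comp_continuousOn hcont) continuousOn_const
  apply Lp.ext
  refine (h3 j i).trans (Filter.EventuallyEq.trans ?_ (Lp.coeFn_zero ℂ 2 (G.μ j)).symm)
  filter_upwards [G.ae_Ioo j] with x hx
  have hf0 : ∀ y ∈ Ioo 0 (G.ℓ j), f j y = 0 := fun y hy =>
    funext fun i => heq i ⟨hy.1.le, hy.2.le⟩
  have hd : deriv (f j) x = 0 := by
    have : f j =ᶠ[nhds x] fun _ => 0 := by
      filter_upwards [Ioo_mem_nhds hx.1 hx.2] with y hy using hf0 y hy
    rw [this.deriv_eq]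
    simp
  simp [diracExpr, hd, hf0 x hx]

/-- The operator `T_τ` in `L²(G)`: the Dirac–Krein expression on each edge, on the functions that
satisfy the outer boundary conditions and the Robin matching condition with parameter `τ`. -/
def T (τ : EReal) : G.H →ₗ.[ℂ] G.H := (G.robinGraph τ).toLinearPMap

theorem T_graph (τ : EReal) : (G.T τ).graph = G.robinGraph τ :=
  Submodule.toLinearPMap_graph_eq _ (G.robinGraph_single_valued τ)

/-- `Y` is a fundamental matrix on the edge `e_j`: `-J Y' + V_j Y = z Y`, `Y(v) = I₂`. -/
def IsFundamentalMatrix (j : Fin n) (z : ℂ) (Y : ℝ → Matrix (Fin 2) (Fin 2) ℂ) : Prop :=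
  Y 0 = 1 ∧ ∀ k, AbsolutelyContinuousOnInterval (fun x i => Y x i k) 0 (G.ℓ j) ∧
    ∀ᵐ x ∂(G.μ j), G.diracExpr j (fun x i => Y x i k) x = z • fun i => Y x i k

/-- The fundamental matrix `Y_j(·, z)` (it exists, and it is unique on the edge). -/
def Y (j : Fin n) (z : ℂ) : ℝ → Matrix (Fin 2) (Fin 2) ℂ :=
  Classical.epsilon (G.IsFundamentalMatrix j z)

/-- The numerator `b_j` of the Weyl–Titchmarsh function. -/
def b (j : Fin n) (z : ℂ) : ℂ :=
  G.Y j z (G.ℓ j) 0 0 * Real.cos (G.α j) + G.Y j z (G.ℓ j) 1 0 * Real.sin (G.α j)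

/-- The denominator `c_j` of the Weyl–Titchmarsh function. -/
def c (j : Fin n) (z : ℂ) : ℂ :=
  G.Y j z (G.ℓ j) 0 1 * Real.cos (G.α j) + G.Y j z (G.ℓ j) 1 1 * Real.sin (G.α j)

/-- The Weyl–Titchmarsh function `m_j` of the edge `e_j`, a meromorphic function on `ℂ`. -/
def m (j : Fin n) (z : ℂ) : ℂ := G.b j z / G.c j z

/-- `z` is a pole of `m_j`. -/
def IsPole (j : Fin n) (z : ℂ) : Prop := meromorphicOrderAt (G.m j) z < 0

/-- `z` solves `∑ m_j(z) = -1/τ`, with `1/(±∞) = 0`; in particular `z` is not a pole. -/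
def IsWeylSolution (τ : EReal) (z : ℂ) : Prop :=
  (∀ j, ¬ G.IsPole j z) ∧ ∑ j, G.m j z = -(((τ⁻¹).toReal : ℝ) : ℂ)

end DiracStarGraph

namespace LinearPMap

variable {E : Type*} [AddCommGroup E] [Module ℂ E]

/-- The space `ker (A - z)` for an operator `A` that need not be everywhere defined. -/
def eigenKer (A : E →ₗ.[ℂ] E) (z : ℂ) : Submodule ℂ A.domain :=
  LinearMap.ker (A.toFun - z • A.domain.subtype)

/-- `z` belongs to the point spectrum of `A`. -/
def IsEigenvalue (A : E →ₗ.[ℂ] E) (z : ℂ) : Prop := A.eigenKer z ≠ ⊥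

/-- The multiplicity `dim ker (A - z)`. -/
def multiplicity (A : E →ₗ.[ℂ] E) (z : ℂ) : ℕ∞ :=
  Cardinal.toENat (Module.rank ℂ (A.eigenKer z))

/-- `a` lists all eigenvalues of `A` in nondecreasing order, each as often as its multiplicity
(in particular they are real). -/
def IsEigenvalueEnumeration (A : E →ₗ.[ℂ] E) (a : ℤ → ℝ) : Prop :=
  Monotone a ∧ ∀ z : ℂ, {k : ℤ | (a k : ℂ) = z}.encard = A.multiplicity z

/-- The eigenvalues of `A` and `B`, counted with multiplicities, interlace. -/
def EigenvaluesInterlace (A B : E →ₗ.[ℂ] E) : Prop :=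
  ∃ a b : ℤ → ℝ, A.IsEigenvalueEnumeration a ∧ B.IsEigenvalueEnumeration b ∧
    ∀ k, a k ≤ b k ∧ b k ≤ a (k + 1)

end LinearPMap

end

/-
For `z = x` real, `b_j' c_j - b_j c_j' > 0` by the Lagrange identity, so `m_j = b_j / c_j` increases
between consecutive zeros of `c_j`, which are its poles; for nonreal `z`, the same identity gives
`Im z · Im m_j(z) > 0`. Hence `∑ m_j` increases from `-∞` to `∞` on each gap between consecutive
poles, and takes every value `-1/τ` exactly once there, at a point that moves to the right as `-1/τ`
increases. There are infinitely many poles in both directions: the Prüfer phase of the second column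
of the fundamental matrix at `v_j` differs from `x ℓ_j` by at most the `L¹` norm of the potential.
An eigenfunction of `T_τ` is determined by its values at the central vertex. At a solution of (1)
they form a line; at a common pole of `ν + 1` of the `m_j` they form the space of those `ν + 1`
numbers `f̂_j(v)` that have sum `0`. For `τ = 0` this last condition is absent, so that the
eigenvalues of `T_0` are the poles of the `m_j`, each in as many copies as there are `j` with this
pole, and they separate the eigenvalues of all other `T_τ`.
-/

noncomputable section

section AbsolutelyContinuous

theorem absolutelyContinuousOnInterval_of_dist_le {X X' : Type*} [PseudoMetricSpace X]
    [PseudoMetricSpace X'] {f : ℝ → X} {g : ℝ → X'} {a b : ℝ} (C : ℝ)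
    (hg : AbsolutelyContinuousOnInterval g a b)
    (h : ∀ x ∈ uIcc a b, ∀ y ∈ uIcc a b, dist (f x) (f y) ≤ C * dist (g x) (g y)) :
    AbsolutelyContinuousOnInterval f a b := by
  have hlim := Filter.Tendsto.const_mul C hg
  rw [mul_zero] at hlim
  refine squeeze_zero'
    (Filter.Eventually.of_forall fun E => Finset.sum_nonneg fun _ _ => dist_nonneg) ?_ hlim
  refine Filter.eventually_inf_principal.2 (Filter.Eventually.of_forall fun E hE => ?_)
  rw [Finset.mul_sum]
  exact Finset.sum_le_sum fun i hi => h _ (hE.1 i hi).1 _ (hE.1 i hi).2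

theorem absolutelyContinuousOnInterval_apply {ι : Type*} [Fintype ι] {E : ι → Type*}
    [∀ i, PseudoMetricSpace (E i)] {f : ℝ → ∀ i, E i} {a b : ℝ}
    (hf : AbsolutelyContinuousOnInterval f a b) (i : ι) :
    AbsolutelyContinuousOnInterval (fun x => f x i) a b :=
  absolutelyContinuousOnInterval_of_dist_le 1 hf fun x _ y _ => by
    simpa using dist_le_pi_dist (f x) (f y) i

variable {W : Type*} [NormedAddCommGroup W] [NormedSpace ℝ W] {f g : ℝ → W} {a b : ℝ}

theorem absolutelyContinuousOnInterval_integral (hg : IntervalIntegrable g volume a b) :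
    AbsolutelyContinuousOnInterval (fun x => ∫ t in a..x, g t) a b := by
  refine absolutelyContinuousOnInterval_of_dist_le 1
    (hg.norm.absolutelyContinuousOnInterval_intervalIntegral left_mem_uIcc) fun x hx y hy => ?_
  have hax := hg.mono_set (uIcc_subset_uIcc_left hx)
  have hay := hg.mono_set (uIcc_subset_uIcc_left hy)
  rw [dist_eq_norm, dist_eq_norm, intervalIntegral.integral_interval_sub_left hax hay,
    intervalIntegral.integral_interval_sub_left hax.norm hay.norm, one_mul, Real.norm_eq_abs]
  exact intervalIntegral.norm_integral_le_abs_integral_norm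

theorem absolutelyContinuousOnInterval_of_eq_integral {w : W}
    (hg : IntervalIntegrable g volume a b) (h : ∀ x ∈ uIcc a b, f x = w + ∫ t in a..x, g t) :
    AbsolutelyContinuousOnInterval f a b :=
  absolutelyContinuousOnInterval_of_dist_le 1 (absolutelyContinuousOnInterval_integral hg)
    fun x hx y hy => by rw [h x hx, h y hy, one_mul, dist_add_left]

theorem integral_eq_sub_of_absolutelyContinuousOnInterval [CompleteSpace W]
    (hf : AbsolutelyContinuousOnInterval f a b) (hg : IntervalIntegrable g volume a b)
    (h : ∀ᵐ x, x ∈ uIcc a b → HasDerivAt f (g x) x) :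
    ∫ x in a..b, g x = f b - f a := by
  have hdiff := hf.sub (absolutelyContinuousOnInterval_integral hg)
  obtain ⟨C, hC⟩ := hdiff.const_of_ae_hasDerivAt_zero (by
    filter_upwards [h, hg.ae_hasDerivAt_integral] with x hfx hgx hx
    simpa using (hfx hx).sub (hgx hx a left_mem_uIcc))
  have ha := hC a left_mem_uIcc
  have hb := hC b right_mem_uIcc
  simp only [Pi.sub_apply, intervalIntegral.integral_same, sub_zero] at ha hb
  rw [ha, ← hb, sub_sub_cancel]

theorem ae_hasDerivAt_of_eq_integral [CompleteSpace W] {w : W} (hab : a ≤ b)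
    (hg : IntervalIntegrable g volume a b) (h : ∀ x ∈ uIcc a b, f x = w + ∫ t in a..x, g t) :
    ∀ᵐ x, x ∈ uIcc a b → HasDerivAt f (g x) x := by
  filter_upwards [hg.ae_hasDerivAt_integral, Measure.ae_ne volume a, Measure.ae_ne volume b]
    with x hx hxa hxb hxm
  refine ((hx hxm a left_mem_uIcc).const_add w).congr_of_eventuallyEq ?_
  rw [uIcc_of_le hab] at hxm h
  filter_upwards [Icc_mem_nhds (hxm.1.lt_of_ne hxa.symm) (hxm.2.lt_of_ne hxb)] with y hy
    using h y hy

theorem integral_mul_primitive_pow {k : ℝ → ℝ} (hk : IntervalIntegrable k volume a b) (n : ℕ) :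
    ∫ t in a..b, k t * (∫ s in a..t, k s) ^ n = (∫ s in a..b, k s) ^ (n + 1) / (n + 1) := by
  set K : ℝ → ℝ := fun t => ∫ s in a..t, k s with hK
  have hpow (m : ℕ) : AbsolutelyContinuousOnInterval (fun t => K t ^ m) a b := by
    induction m with
    | zero =>
      simpa using (LipschitzWith.const (1 : ℝ)).lipschitzOnWith.absolutelyContinuousOnInterval
    | succ m ih =>
      simpa only [pow_succ] using ih.fun_mul (absolutelyContinuousOnInterval_integral hk)
  have hint := integral_eq_sub_of_absolutelyContinuousOnInterval (hpow (n + 1))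
    (g := fun t => (n + 1) * (k t * K t ^ n))
    ((hk.mul_continuousOn (hpow n).continuousOn).const_mul _) (by
      filter_upwards [hk.ae_hasDerivAt_integral] with t ht htm
      have := (ht htm a left_mem_uIcc).pow (n + 1)
      simp only [Nat.cast_add, Nat.cast_one, Nat.add_sub_cancel] at this
      exact this.congr_deriv (by simp only [hK]; ring))
  have hKa : K a = 0 := by simp [hK]
  rw [intervalIntegral.integral_const_mul, hKa, zero_pow n.succ_ne_zero, sub_zero] at hint
  rw [eq_div_iff (by positivity), mul_comm, hint]

end AbsolutelyContinuous

section Volterra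

variable {𝕜 W : Type*} [NontriviallyNormedField 𝕜] [NormedAddCommGroup W] [NormedSpace 𝕜 W]
  {a b : ℝ}

theorem intervalIntegrable_clm_apply {A : ℝ → W →L[𝕜] W} {f : ℝ → W}
    (hA : IntervalIntegrable A volume a b) (hf : ContinuousOn f (uIcc a b)) :
    IntervalIntegrable (fun t => A t (f t)) volume a b := by
  obtain ⟨C, hC⟩ := isCompact_uIcc.exists_bound_of_continuousOn hf
  rw [intervalIntegrable_iff] at hA ⊢
  have hm : AEStronglyMeasurable f (volume.restrict (uIoc a b)) :=
    (hf.mono uIoc_subset_uIcc).aestronglyMeasurable measurableSet_uIoc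
  refine Integrable.mono' (hA.norm.mul_const C)
    ((ContinuousLinearMap.id 𝕜 (W →L[𝕜] W)).aestronglyMeasurable_comp₂ hA.1 hm) ?_
  exact ae_restrict_of_forall_mem measurableSet_uIoc fun t ht =>
    (A t).le_opNorm_of_le (hC t (uIoc_subset_uIcc ht))

variable (hab : a ≤ b) {A : ℝ → W →L[𝕜] W}

theorem intervalIntegrable_clm_apply_IccExtend (hA : IntervalIntegrable A volume a b)
    (f : C(Icc a b, W)) {x : ℝ} (hx : x ∈ Icc a b) :
    IntervalIntegrable (fun t => A t (IccExtend hab f t)) volume a x :=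
  (intervalIntegrable_clm_apply hA
    (f.continuous.Icc_extend' (h := hab)).continuousOn).mono_set
      (uIcc_subset_uIcc_left (by rwa [uIcc_of_le hab]))

variable [NormedSpace ℝ W]

theorem continuous_integral_clm_apply_IccExtend (hA : IntervalIntegrable A volume a b)
    (f : C(Icc a b, W)) :
    Continuous fun x : Icc a b => ∫ t in a..x, A t (IccExtend hab f t) := by
  have hint := intervalIntegrable_clm_apply_IccExtend hab hA f (right_mem_Icc.2 hab)
  have hcont := intervalIntegral.continuousOn_primitive_interval (μ := volume)
    ((intervalIntegrable_iff_integrableOn_Icc_of_le hab).1 hint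
      |>.mono_set (by rw [uIcc_of_le hab]))
  rw [uIcc_of_le hab] at hcont
  exact hcont.domRestrict

variable [SMulCommClass ℝ 𝕜 W] (hA : IntervalIntegrable A volume a b)

/-- The Volterra operator `f ↦ (x ↦ ∫ₐˣ A f)` on `C([a, b], W)` of an integrable family `A` of
bounded operators; `u' = A u`, `u(a) = w` means `(1 - volterraOperator) u = w`. -/
def volterraOperator : C(Icc a b, W) →L[𝕜] C(Icc a b, W) :=
  LinearMap.mkContinuous
    { toFun := fun f => ⟨fun x : Icc a b => ∫ t in a..x, A t (IccExtend hab f t),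
        continuous_integral_clm_apply_IccExtend hab hA f⟩
      map_add' := fun f g => by
        ext x
        refine Eq.trans ?_ (intervalIntegral.integral_add
          (intervalIntegrable_clm_apply_IccExtend hab hA f x.2)
          (intervalIntegrable_clm_apply_IccExtend hab hA g x.2))
        simp [IccExtend]
      map_smul' := fun c f => by
        ext x
        refine Eq.trans ?_ (intervalIntegral.integral_smul c _)
        simp [IccExtend] }
    (∫ t in a..b, ‖A t‖) fun f => by
      refine (ContinuousMap.norm_le _ (mul_nonneg (intervalIntegral.integral_nonneg hab
        fun _ _ => norm_nonneg _) (norm_nonneg _))).2 fun x => ?_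
      have hx := hA.mono_set (uIcc_subset_uIcc_left (by rw [uIcc_of_le hab]; exact x.2))
      refine (intervalIntegral.norm_integral_le_of_norm_le (g := fun t => ‖A t‖ * ‖f‖) x.2.1
        (Filter.Eventually.of_forall fun t _ => (A t).le_opNorm_of_le (f.norm_coe_le_norm _))
        (hx.norm.mul_const _)).trans ?_
      rw [intervalIntegral.integral_mul_const]
      refine mul_le_mul_of_nonneg_right ?_ (norm_nonneg _)
      exact intervalIntegral.integral_mono_interval le_rfl x.2.1 x.2.2
        (Filter.Eventually.of_forall fun _ => norm_nonneg _) hA.norm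

theorem volterraOperator_apply (f : C(Icc a b, W)) (x : Icc a b) :
    volterraOperator hab hA f x = ∫ t in a..x, A t (IccExtend hab f t) := rfl

theorem norm_volterraOperator_pow_apply_le (n : ℕ) (f : C(Icc a b, W)) (x : Icc a b) :
    ‖(volterraOperator hab hA ^ n) f x‖ ≤ (∫ t in a..x, ‖A t‖) ^ n / n.factorial * ‖f‖ := by
  induction n generalizing x with
  | zero => simpa using f.norm_coe_le_norm x
  | succ n ih =>
    have hx := hA.norm.mono_set (uIcc_subset_uIcc_left (by rw [uIcc_of_le hab]; exact x.2))
    have hprim := (absolutelyContinuousOnInterval_integral hx).continuousOn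
    rw [pow_succ', mul_apply_eq_comp, volterraOperator_apply]
    refine (intervalIntegral.norm_integral_le_of_norm_le
      (g := fun t => ‖A t‖ * (∫ s in a..t, ‖A s‖) ^ n * (‖f‖ / n.factorial)) x.2.1
      (Filter.Eventually.of_forall fun t ht => ?_) ?_).trans (le_of_eq ?_)
    · have htm : t ∈ Icc a b := ⟨ht.1.le, ht.2.trans x.2.2⟩
      refine ((A t).le_opNorm _).trans ?_
      rw [IccExtend_of_mem hab _ htm, mul_assoc]
      refine mul_le_mul_of_nonneg_left ((ih ⟨t, htm⟩).trans (le_of_eq ?_)) (norm_nonneg _)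
      ring
    · exact (hx.mul_continuousOn (hprim.pow n)).mul_const _
    · rw [intervalIntegral.integral_mul_const, integral_mul_primitive_pow hx, Nat.factorial_succ]
      push_cast
      field_simp

theorem norm_volterraOperator_pow_le (n : ℕ) :
    ‖volterraOperator hab hA ^ n‖ ≤ (∫ t in a..b, ‖A t‖) ^ n / n.factorial := by
  have hnonneg (x : ℝ) (hx : a ≤ x) : 0 ≤ ∫ t in a..x, ‖A t‖ :=
    intervalIntegral.integral_nonneg hx fun _ _ => norm_nonneg _
  have hbound : 0 ≤ (∫ t in a..b, ‖A t‖) ^ n / n.factorial := by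
    have := hnonneg b hab
    positivity
  refine ContinuousLinearMap.opNorm_le_bound _ hbound fun f => ?_
  refine (ContinuousMap.norm_le _ (by positivity)).2 fun x => ?_
  refine (norm_volterraOperator_pow_apply_le hab hA n f x).trans ?_
  gcongr
  · exact hnonneg x x.2.1
  · exact intervalIntegral.integral_mono_interval le_rfl x.2.1 x.2.2
      (Filter.Eventually.of_forall fun _ => norm_nonneg _) hA.norm

theorem isUnit_one_sub_volterraOperator [CompleteSpace W] :
    IsUnit (1 - volterraOperator hab hA) := by
  set K := volterraOperator hab hA
  obtain ⟨n, hn⟩ := ((FloorSemiring.tendsto_pow_div_factorial_atTop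
    (∫ t in a..b, ‖A t‖)).eventually_lt_const one_pos).exists
  have hpow : IsUnit (1 - K ^ n) :=
    isUnit_one_sub_of_norm_lt_one (x := K ^ n)
      ((norm_volterraOperator_pow_le hab hA n).trans_lt hn)
  rw [← mul_neg_geom_sum] at hpow
  refine ((Commute.isUnit_mul_iff ?_).1 hpow).1
  exact Commute.sum_right _ _ _ fun i _ =>
    ((Commute.one_left K).sub_left (Commute.refl K)).pow_right i

end Volterra

section LinearODE

variable {𝕜 W : Type*} [NontriviallyNormedField 𝕜] [NormedAddCommGroup W] [NormedSpace 𝕜 W]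
  {a b : ℝ}

theorem differentiable_inverse_one_sub_add_smul {R : Type*} [NormedRing R] [NormedAlgebra 𝕜 R]
    [HasSummableGeomSeries R] {r s : R} (h : ∀ z : 𝕜, IsUnit (1 - (r + z • s))) :
    Differentiable 𝕜 fun z : 𝕜 => Ring.inverse (1 - (r + z • s)) := fun z =>
  (differentiableAt_inverse (h z)).fun_comp' z
    (by fun_prop : DifferentiableAt 𝕜 (fun z : 𝕜 => 1 - (r + z • s)) z)

variable [NormedSpace ℝ W] [SMulCommClass ℝ 𝕜 W] [CompleteSpace W]

theorem exists_differentiable_solution (hab : a ≤ b) {A₀ A₁ : ℝ → W →L[𝕜] W}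
    (h₀ : IntervalIntegrable A₀ volume a b) (h₁ : IntervalIntegrable A₁ volume a b) (w : W) :
    ∃ u : 𝕜 → C(Icc a b, W), Differentiable 𝕜 u ∧ ∀ z (x : Icc a b),
      u z x = w + ∫ t in a..x, (A₀ t + z • A₁ t) (IccExtend hab (u z) t) := by
  set K₀ := volterraOperator hab h₀
  set K₁ := volterraOperator hab h₁
  have hint (z : 𝕜) : IntervalIntegrable (fun t => A₀ t + z • A₁ t) volume a b :=
    h₀.add (h₁.smul z)
  have hK (z : 𝕜) : volterraOperator hab (hint z) = K₀ + z • K₁ := by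
    ext f x
    exact (intervalIntegral.integral_add (intervalIntegrable_clm_apply_IccExtend hab h₀ f x.2)
      ((intervalIntegrable_clm_apply_IccExtend hab h₁ f x.2).smul z)).trans
        (congrArg _ (intervalIntegral.integral_smul z _))
  have hu (z : 𝕜) : IsUnit (1 - (K₀ + z • K₁)) := hK z ▸ isUnit_one_sub_volterraOperator hab _
  refine ⟨fun z => Ring.inverse (1 - (K₀ + z • K₁)) (ContinuousMap.const _ w), fun z =>
    (differentiable_inverse_one_sub_add_smul hu z).clm_apply (differentiableAt_const _),
    fun z x => ?_⟩
  have hmul := congrArg (fun T : C(Icc a b, W) →L[𝕜] C(Icc a b, W) => T (ContinuousMap.const _ w) x)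
    (Ring.mul_inverse_cancel _ (hu z))
  simp only [mul_apply_eq_comp, ← hK] at hmul ⊢
  rw [← volterraOperator_apply hab (hint z)]
  simpa [sub_eq_iff_eq_add] using hmul

variable {A : ℝ → W →L[𝕜] W} {f g : ℝ → W}

theorem eqOn_zero_of_eq_integral (hab : a ≤ b) (hA : IntervalIntegrable A volume a b)
    (hf : ContinuousOn f (Icc a b)) (h : ∀ x ∈ Icc a b, f x = ∫ t in a..x, A t (f t)) :
    EqOn f 0 (Icc a b) := by
  let F : C(Icc a b, W) := ⟨fun x => f x, hf.domRestrict⟩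
  have hker : (1 - volterraOperator hab hA) F = 0 := by
    ext x
    rw [_root_.sub_apply, ContinuousMap.sub_apply, volterraOperator_apply]
    refine sub_eq_zero.2 ((h x x.2).trans (intervalIntegral.integral_congr fun t ht => ?_))
    rw [uIcc_of_le x.2.1] at ht
    simp only [IccExtend_of_mem hab _ (⟨ht.1, ht.2.trans x.2.2⟩ : t ∈ Icc a b)]
    rfl
  have hF : F = 0 := by
    have := congrArg (fun T : C(Icc a b, W) →L[𝕜] C(Icc a b, W) => T F)
      (Ring.inverse_mul_cancel _ (isUnit_one_sub_volterraOperator hab hA))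
    simp only [mul_apply_eq_comp, hker, map_zero] at this
    exact this.symm
  exact fun x hx => DFunLike.congr_fun hF ⟨x, hx⟩

theorem eqOn_of_ae_hasDerivAt_clm_apply (hab : a ≤ b) (hA : IntervalIntegrable A volume a b)
    (hf : AbsolutelyContinuousOnInterval f a b) (hg : AbsolutelyContinuousOnInterval g a b)
    (hf' : ∀ᵐ x, x ∈ uIcc a b → HasDerivAt f (A x (f x)) x)
    (hg' : ∀ᵐ x, x ∈ uIcc a b → HasDerivAt g (A x (g x)) x) (ha : f a = g a) :
    EqOn f g (Icc a b) := by
  have hd := hf.sub hg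
  have hint := intervalIntegrable_clm_apply hA hd.continuousOn
  have hzero : EqOn (f - g) 0 (Icc a b) := by
    refine eqOn_zero_of_eq_integral hab hA (uIcc_of_le hab ▸ hd.continuousOn) fun x hx => ?_
    have hsub : uIcc a x ⊆ uIcc a b := uIcc_subset_uIcc_left (by rwa [uIcc_of_le hab])
    rw [integral_eq_sub_of_absolutelyContinuousOnInterval (hd.mono hsub) (hint.mono_set hsub)]
    · simp [ha]
    · filter_upwards [hf', hg'] with t hft hgt ht
      simpa using (hft (hsub ht)).sub (hgt (hsub ht))
  exact fun x hx => sub_eq_zero.1 (hzero hx)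

end LinearODE

namespace DiracStarGraph

open scoped ComplexConjugate

variable {n : ℕ} (G : DiracStarGraph n) (j : Fin n)

section Solutions

/-- `f` solves `-J f' + V_j f = z f` on the edge `e_j`. -/
def IsSolution (z : ℂ) (f : ℝ → Fin 2 → ℂ) : Prop :=
  AbsolutelyContinuousOnInterval f 0 (G.ℓ j) ∧ ∀ᵐ x ∂(G.μ j), G.diracExpr j f x = z • f x

theorem ae_μ_iff {P : ℝ → Prop} : (∀ᵐ x ∂(G.μ j), P x) ↔ ∀ᵐ x, x ∈ uIcc 0 (G.ℓ j) → P x := by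
  rw [uIcc_of_le (G.ℓ_pos j).le]
  exact ae_restrict_iff' measurableSet_Icc

/-- The operator `-J V_j` in `f' = (-J V_j + z J) f`, which is `-J f' + V_j f = z f` solved for
`f'`. -/
def potentialCoef (x : ℝ) : (Fin 2 → ℂ) →L[ℂ] (Fin 2 → ℂ) :=
  (G.p j x : ℂ) • (mulVecLin !![0, -1; -1, 0]).toContinuousLinearMap +
    (G.q j x : ℂ) • (mulVecLin !![1, 0; 0, -1]).toContinuousLinearMap

/-- The operator `J`, the coefficient of the spectral parameter in `f' = (-J V_j + z J) f`. -/
def spectralCoef : (Fin 2 → ℂ) →L[ℂ] (Fin 2 → ℂ) := (mulVecLin J).toContinuousLinearMap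

theorem potentialCoef_add_smul_spectralCoef_apply (z : ℂ) (x : ℝ) (v : Fin 2 → ℂ) :
    (G.potentialCoef j x + z • spectralCoef) v =
      ![G.q j x * v 0 - (G.p j x + z) * v 1, (z - G.p j x) * v 0 - G.q j x * v 1] := by
  ext i
  fin_cases i <;>
    simp [potentialCoef, spectralCoef, J, dotProduct, Fin.sum_univ_two, -Fin.mk_one,
      -Fin.zero_eta] <;> ring

theorem intervalIntegrable_p : IntervalIntegrable (fun x => (G.p j x : ℂ)) volume 0 (G.ℓ j) :=
  (intervalIntegrable_iff_integrableOn_Icc_of_le (G.ℓ_pos j).le).2 (G.p_integrable j).ofReal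

theorem intervalIntegrable_q : IntervalIntegrable (fun x => (G.q j x : ℂ)) volume 0 (G.ℓ j) :=
  (intervalIntegrable_iff_integrableOn_Icc_of_le (G.ℓ_pos j).le).2 (G.q_integrable j).ofReal

theorem intervalIntegrable_potentialCoef :
    IntervalIntegrable (G.potentialCoef j) volume 0 (G.ℓ j) := by
  have hsmul {f : ℝ → ℂ} (B : (Fin 2 → ℂ) →L[ℂ] (Fin 2 → ℂ))
      (hf : IntervalIntegrable f volume 0 (G.ℓ j)) :
      IntervalIntegrable (fun x => f x • B) volume 0 (G.ℓ j) :=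
    ⟨hf.1.smul_const B, hf.2.smul_const B⟩
  exact (hsmul _ (G.intervalIntegrable_p j)).add (hsmul _ (G.intervalIntegrable_q j))

variable {G j} {z w : ℂ} {f g : ℝ → Fin 2 → ℂ}

theorem diracExpr_eq_smul_iff {x : ℝ} (hf : DifferentiableAt ℝ f x) :
    G.diracExpr j f x = z • f x ↔
      HasDerivAt f ((G.potentialCoef j x + z • spectralCoef) (f x)) x := by
  have hderiv {v : Fin 2 → ℂ} : HasDerivAt f v x ↔ deriv f x = v :=
    ⟨HasDerivAt.deriv, fun h => h ▸ hf.hasDerivAt⟩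
  rw [hderiv, potentialCoef_add_smul_spectralCoef_apply, funext_iff, funext_iff,
    Fin.forall_fin_two, Fin.forall_fin_two]
  simp only [diracExpr, J, V, mulVec, dotProduct, Fin.sum_univ_two, Pi.add_apply, Pi.neg_apply,
    of_apply, cons_val_zero, cons_val_one, Pi.smul_apply, smul_eq_mul]
  constructor
  · rintro ⟨h₀, h₁⟩
    exact ⟨by linear_combination -h₁, by linear_combination h₀⟩
  · rintro ⟨h₀, h₁⟩
    exact ⟨by linear_combination h₁, by linear_combination -h₀⟩

theorem IsSolution.ae_hasDerivAt (hf : G.IsSolution j z f) : ∀ᵐ x, x ∈ uIcc 0 (G.ℓ j) →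
    HasDerivAt f ((G.potentialCoef j x + z • spectralCoef) (f x)) x := by
  rw [← ae_μ_iff]
  filter_upwards [hf.2, G.ae_differentiableAt j hf.1] with x hx hdiff
  exact (diracExpr_eq_smul_iff hdiff).1 hx

theorem isSolution_of_ae_hasDerivAt (hf : AbsolutelyContinuousOnInterval f 0 (G.ℓ j))
    (h : ∀ᵐ x, x ∈ uIcc 0 (G.ℓ j) →
      HasDerivAt f ((G.potentialCoef j x + z • spectralCoef) (f x)) x) :
    G.IsSolution j z f := by
  rw [← ae_μ_iff] at h
  refine ⟨hf, ?_⟩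
  filter_upwards [h] with x hx
  exact (diracExpr_eq_smul_iff hx.differentiableAt).2 hx

theorem IsSolution.continuousOn (hf : G.IsSolution j z f) : ContinuousOn f (Icc 0 (G.ℓ j)) :=
  uIcc_of_le (G.ℓ_pos j).le ▸ hf.1.continuousOn

theorem IsSolution.continuousOn_apply (hf : G.IsSolution j z f) (i : Fin 2) :
    ContinuousOn (fun x => f x i) (Icc 0 (G.ℓ j)) :=
  (continuous_apply i).comp_continuousOn hf.continuousOn

theorem IsSolution.eqOn (hf : G.IsSolution j z f) (hg : G.IsSolution j z g) (h0 : f 0 = g 0) :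
    EqOn f g (Icc 0 (G.ℓ j)) :=
  eqOn_of_ae_hasDerivAt_clm_apply (G.ℓ_pos j).le
    ((G.intervalIntegrable_potentialCoef j).add intervalIntegrable_const) hf.1 hg.1
    hf.ae_hasDerivAt hg.ae_hasDerivAt h0

theorem IsSolution.add (hf : G.IsSolution j z f) (hg : G.IsSolution j z g) :
    G.IsSolution j z (fun x => f x + g x) :=
  isSolution_of_ae_hasDerivAt (hf.1.add hg.1) (by
    filter_upwards [hf.ae_hasDerivAt, hg.ae_hasDerivAt] with x hfx hgx hx
    rw [map_add]
    exact (hfx hx).add (hgx hx))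

theorem IsSolution.const_smul (hf : G.IsSolution j z f) (c : ℂ) :
    G.IsSolution j z (fun x => c • f x) :=
  isSolution_of_ae_hasDerivAt (hf.1.const_smul c) (by
    filter_upwards [hf.ae_hasDerivAt] with x hfx hx
    rw [map_smul]
    exact (hfx hx).const_smul c)

theorem IsSolution.conj (hf : G.IsSolution j z f) :
    G.IsSolution j (conj z) (fun x i => conj (f x i)) := by
  refine isSolution_of_ae_hasDerivAt
    (absolutelyContinuousOnInterval_of_dist_le 1 hf.1 fun x _ y _ => ?_) ?_
  · rw [one_mul]
    refine (dist_pi_le_iff dist_nonneg).2 fun i => ?_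
    rw [Complex.dist_conj_conj]
    exact dist_le_pi_dist _ _ i
  · filter_upwards [hf.ae_hasDerivAt] with x hfx hx
    refine hasDerivAt_pi.2 fun i => ((hasDerivAt_pi.1 (hfx hx) i).star).congr_deriv ?_
    rw [potentialCoef_add_smul_spectralCoef_apply, potentialCoef_add_smul_spectralCoef_apply]
    fin_cases i <;> simp

variable (G j)

theorem exists_isSolution (v : Fin 2 → ℂ) :
    ∃ u : ℂ → C(Icc 0 (G.ℓ j), Fin 2 → ℂ), Differentiable ℂ u ∧ ∀ z,
      IccExtend (G.ℓ_pos j).le (u z) 0 = v ∧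
      G.IsSolution j z (IccExtend (G.ℓ_pos j).le (u z)) := by
  have hℓ := (G.ℓ_pos j).le
  have hcoef := G.intervalIntegrable_potentialCoef j
  obtain ⟨u, hu, hint⟩ := exists_differentiable_solution hℓ hcoef
    (intervalIntegrable_const (c := spectralCoef)) v
  refine ⟨u, hu, fun z => ?_⟩
  have hinteg := intervalIntegrable_clm_apply
    (hcoef.add (intervalIntegrable_const (c := z • spectralCoef)))
    ((u z).continuous.Icc_extend' (h := hℓ)).continuousOn
  have heq (x) (hx : x ∈ uIcc 0 (G.ℓ j)) : IccExtend hℓ (u z) x =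
      v + ∫ t in (0 : ℝ)..x, (G.potentialCoef j t + z • spectralCoef) (IccExtend hℓ (u z) t) := by
    rw [uIcc_of_le hℓ] at hx
    rw [IccExtend_of_mem hℓ _ hx, hint z ⟨x, hx⟩]
  exact ⟨by simpa using heq 0 left_mem_uIcc, isSolution_of_ae_hasDerivAt
    (absolutelyContinuousOnInterval_of_eq_integral hinteg heq)
    (ae_hasDerivAt_of_eq_integral hℓ hinteg heq)⟩

theorem isFundamentalMatrix_Y (z : ℂ) : G.IsFundamentalMatrix j z (G.Y j z) := by
  refine Classical.epsilon_spec (p := G.IsFundamentalMatrix j z) ?_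
  choose u _ hu using fun k : Fin 2 => G.exists_isSolution j (Pi.single k 1)
  refine ⟨fun x => of fun i k => IccExtend (G.ℓ_pos j).le (u k z) x i, ?_, fun k => (hu k z).2⟩
  ext i k
  simp only [of_apply, (hu k z).1, Pi.single_apply, one_apply]

/-- The `k`-th column of the fundamental matrix. -/
def col (k : Fin 2) (z : ℂ) (x : ℝ) : Fin 2 → ℂ := fun i => G.Y j z x i k

theorem col_zero (k : Fin 2) (z : ℂ) : G.col j k z 0 = Pi.single k 1 := by
  ext i
  simp [col, (G.isFundamentalMatrix_Y j z).1, one_apply, Pi.single_apply]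

theorem isSolution_col (k : Fin 2) (z : ℂ) : G.IsSolution j z (G.col j k z) :=
  (G.isFundamentalMatrix_Y j z).2 k

theorem exists_differentiable_col (k : Fin 2) :
    ∃ u : ℂ → C(Icc 0 (G.ℓ j), Fin 2 → ℂ), Differentiable ℂ u ∧
      ∀ z (x : Icc 0 (G.ℓ j)), u z x = G.col j k z x := by
  obtain ⟨u, hu, hsol⟩ := G.exists_isSolution j (Pi.single k 1)
  refine ⟨u, hu, fun z x => ?_⟩
  rw [← (hsol z).2.eqOn (G.isSolution_col j k z) ((hsol z).1.trans (G.col_zero j k z).symm) x.2,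
    IccExtend_of_mem _ _ x.2]

theorem differentiable_col {x : ℝ} (hx : x ∈ Icc 0 (G.ℓ j)) (k i : Fin 2) :
    Differentiable ℂ fun z => G.col j k z x i := by
  obtain ⟨u, hu, hcol⟩ := G.exists_differentiable_col j k
  have heval : (fun z => G.col j k z x i) = fun z =>
      (ContinuousLinearMap.proj (R := ℂ) (φ := fun _ : Fin 2 => ℂ) i)
        (ContinuousMap.evalCLM ℂ (⟨x, hx⟩ : Icc 0 (G.ℓ j)) (u z)) := by
    ext z
    simp [hcol]
  rw [heval]
  fun_prop

theorem col_conj (k : Fin 2) (z : ℂ) {x : ℝ} (hx : x ∈ Icc 0 (G.ℓ j)) (i : Fin 2) :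
    G.col j k (conj z) x i = conj (G.col j k z x i) := by
  refine congrFun ((G.isSolution_col j k (conj z)).eqOn (G.isSolution_col j k z).conj ?_ hx) i
  ext i
  simp only [col_zero, Pi.single_apply]
  split_ifs <;> simp

/-- The solution of `-J f' + V_j f = z f` with initial value `f(0) = v`. -/
def solution (z : ℂ) (v : Fin 2 → ℂ) (x : ℝ) : Fin 2 → ℂ :=
  v 0 • G.col j 0 z x + v 1 • G.col j 1 z x

theorem isSolution_solution (z : ℂ) (v : Fin 2 → ℂ) : G.IsSolution j z (G.solution j z v) :=
  ((G.isSolution_col j 0 z).const_smul _).add ((G.isSolution_col j 1 z).const_smul _)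

theorem solution_zero (z : ℂ) (v : Fin 2 → ℂ) : G.solution j z v 0 = v := by
  ext i
  fin_cases i <;> simp [solution, col_zero]

variable {G j}

theorem IsSolution.eqOn_solution (hf : G.IsSolution j z f) :
    EqOn f (G.solution j z (f 0)) (Icc 0 (G.ℓ j)) :=
  hf.eqOn (G.isSolution_solution j z _) (G.solution_zero j z _).symm

/-- The Wronskian `f̂ g - f ĝ` of two spinors `(f, f̂)` and `(g, ĝ)`. -/
def wronskian (f g : ℝ → Fin 2 → ℂ) (x : ℝ) : ℂ := f x 1 * g x 0 - f x 0 * g x 1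

theorem IsSolution.ae_hasDerivAt_wronskian (hf : G.IsSolution j z f) (hg : G.IsSolution j w g) :
    ∀ᵐ x, x ∈ uIcc 0 (G.ℓ j) →
      HasDerivAt (wronskian f g) ((z - w) * (f x 0 * g x 0 + f x 1 * g x 1)) x := by
  filter_upwards [hf.ae_hasDerivAt, hg.ae_hasDerivAt] with x hfx hgx hx
  have hf' := hasDerivAt_pi.1 (hfx hx)
  have hg' := hasDerivAt_pi.1 (hgx hx)
  refine (((hf' 1).fun_mul (hg' 0)).fun_sub ((hf' 0).fun_mul (hg' 1))).congr_deriv ?_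
  simp only [potentialCoef_add_smul_spectralCoef_apply, cons_val_zero, cons_val_one]
  ring

theorem IsSolution.wronskian_sub_wronskian_zero (hf : G.IsSolution j z f)
    (hg : G.IsSolution j w g) {x : ℝ} (hx : x ∈ Icc 0 (G.ℓ j)) :
    wronskian f g x - wronskian f g 0 =
      (z - w) * ∫ t in (0 : ℝ)..x, (f t 0 * g t 0 + f t 1 * g t 1) := by
  have hℓ := (G.ℓ_pos j).le
  have hsub : uIcc 0 x ⊆ uIcc 0 (G.ℓ j) := uIcc_subset_uIcc_left (by rwa [uIcc_of_le hℓ])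
  have hac := (((absolutelyContinuousOnInterval_apply hf.1 1).fun_smul
    (absolutelyContinuousOnInterval_apply hg.1 0)).fun_sub
      ((absolutelyContinuousOnInterval_apply hf.1 0).fun_smul
        (absolutelyContinuousOnInterval_apply hg.1 1))).mono hsub
  have hcont : ContinuousOn (fun t => (z - w) * (f t 0 * g t 0 + f t 1 * g t 1)) (uIcc 0 x) :=
    (continuousOn_const.mul (((hf.continuousOn_apply 0).mul (hg.continuousOn_apply 0)).add
      ((hf.continuousOn_apply 1).mul (hg.continuousOn_apply 1)))).mono (uIcc_of_le hℓ ▸ hsub)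
  rw [← intervalIntegral.integral_const_mul]
  refine (integral_eq_sub_of_absolutelyContinuousOnInterval hac hcont.intervalIntegrable ?_).symm
  filter_upwards [hf.ae_hasDerivAt_wronskian hg] with t ht htx using ht (hsub htx)

theorem wronskian_col (z : ℂ) {x : ℝ} (hx : x ∈ Icc 0 (G.ℓ j)) :
    wronskian (G.col j 0 z) (G.col j 1 z) x = -1 := by
  have h := (G.isSolution_col j 0 z).wronskian_sub_wronskian_zero (G.isSolution_col j 1 z) hx
  rw [sub_self, zero_mul, sub_eq_zero] at h
  rw [h]
  simp [wronskian, col_zero]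

theorem OuterCondition.wronskian_eq_zero (hf : G.OuterCondition j f) (hg : G.OuterCondition j g) :
    wronskian f g (G.ℓ j) = 0 := by
  have hcs : (Real.cos (G.α j) : ℂ) ^ 2 + (Real.sin (G.α j) : ℂ) ^ 2 = 1 := by
    exact_mod_cast Real.cos_sq_add_sin_sq (G.α j)
  simp only [OuterCondition, wronskian] at hf hg ⊢
  set C := (Real.cos (G.α j) : ℂ)
  set S := (Real.sin (G.α j) : ℂ)
  linear_combination (-(f (G.ℓ j) 1 * g (G.ℓ j) 0 - f (G.ℓ j) 0 * g (G.ℓ j) 1)) * hcs +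
    (C * f (G.ℓ j) 1 - S * f (G.ℓ j) 0) * hg - (C * g (G.ℓ j) 1 - S * g (G.ℓ j) 0) * hf

end Solutions

end DiracStarGraph

section IncreasingOffPoles

open Filter Topology

/-- `f` has a positive derivative off the set `S`, and at each point of `S` it has a pole through
which it jumps from `∞` to `-∞`. -/
structure IsIncreasingOffPoles (f : ℝ → ℝ) (S : Set ℝ) : Prop where
  exists_hasDerivAt_pos : ∀ x ∉ S, ∃ d > 0, HasDerivAt f d x
  tendsto_atTop : ∀ x ∈ S, Tendsto f (𝓝[<] x) atTop
  tendsto_atBot : ∀ x ∈ S, Tendsto f (𝓝[>] x) atBot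

namespace IsIncreasingOffPoles

variable {f g : ℝ → ℝ} {S T : Set ℝ} {u v x : ℝ}

theorem of_div {b c b' c' : ℝ → ℝ} (hb : ∀ x, HasDerivAt b (b' x) x)
    (hc : ∀ x, HasDerivAt c (c' x) x) (h : ∀ x, 0 < b' x * c x - b x * c' x) :
    IsIncreasingOffPoles (fun x => b x / c x) {x | c x = 0} := by
  have hb0 {x} (hx : c x = 0) : b x ≠ 0 := by
    intro hbx
    simpa [hx, hbx] using h x
  have hsign {x} (hx : c x = 0) : ∀ᶠ t in 𝓝 x,
      SignType.sign (c t / b t) = SignType.sign (x - t) := by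
    refine eventually_nhdsWithin_sign_eq_of_deriv_neg ?_ (by simp [hx])
    rw [((hc x).fun_div (hb x) (hb0 hx)).deriv]
    exact div_neg_of_neg_of_pos (by linarith [h x]) (sq_pos_of_ne_zero (hb0 hx))
  have hzero {x} (hx : c x = 0) : Tendsto (fun t => c t / b t) (𝓝 x) (𝓝 0) := by
    simpa [hx] using ((hc x).fun_div (hb x) (hb0 hx)).continuousAt.tendsto
  refine ⟨fun x hx => ⟨_, div_pos (h x) (sq_pos_of_ne_zero hx), (hb x).fun_div (hc x) hx⟩,
    fun x hx => ?_, fun x hx => ?_⟩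
  · suffices Tendsto (fun t => c t / b t) (𝓝[<] x) (𝓝[>] 0) by
      simpa only [Pi.inv_def, inv_div] using this.inv_tendsto_nhdsGT_zero
    refine tendsto_nhdsWithin_iff.2 ⟨(hzero hx).mono_left nhdsWithin_le_nhds, ?_⟩
    filter_upwards [nhdsWithin_le_nhds (hsign hx), self_mem_nhdsWithin] with t ht htx
    rwa [sign_pos (sub_pos.2 htx), sign_eq_one_iff] at ht
  · suffices Tendsto (fun t => c t / b t) (𝓝[>] x) (𝓝[<] 0) by
      simpa only [Pi.inv_def, inv_div] using this.inv_tendsto_nhdsLT_zero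
    refine tendsto_nhdsWithin_iff.2 ⟨(hzero hx).mono_left nhdsWithin_le_nhds, ?_⟩
    filter_upwards [nhdsWithin_le_nhds (hsign hx), self_mem_nhdsWithin] with t ht htx
    rwa [sign_neg (sub_neg.2 htx), sign_eq_neg_one_iff] at ht

theorem continuousAt (hf : IsIncreasingOffPoles f S) (hx : x ∉ S) : ContinuousAt f x :=
  let ⟨_, _, hd⟩ := hf.exists_hasDerivAt_pos x hx
  hd.continuousAt

theorem add (hf : IsIncreasingOffPoles f S) (hg : IsIncreasingOffPoles g T) :
    IsIncreasingOffPoles (fun x => f x + g x) (S ∪ T) := by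
  have hlim {f S} (hf : IsIncreasingOffPoles f S) {x} {l : Filter ℝ} (hl : l ≤ 𝓝 x) (hx : x ∉ S) :
      Tendsto f l (𝓝 (f x)) := (hf.continuousAt hx).tendsto.mono_left hl
  refine ⟨fun x hx => ?_, fun x hx => ?_, fun x hx => ?_⟩
  · rw [mem_union, not_or] at hx
    obtain ⟨d, hd, hdf⟩ := hf.exists_hasDerivAt_pos x hx.1
    obtain ⟨e, he, heg⟩ := hg.exists_hasDerivAt_pos x hx.2
    exact ⟨d + e, add_pos hd he, hdf.fun_add heg⟩
  · by_cases hxS : x ∈ S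
    · by_cases hxT : x ∈ T
      · exact (hf.tendsto_atTop x hxS).atTop_add_atTop (hg.tendsto_atTop x hxT)
      · exact (hf.tendsto_atTop x hxS).atTop_add (hlim hg nhdsWithin_le_nhds hxT)
    · exact (hlim hf nhdsWithin_le_nhds hxS).add_atTop
        (hg.tendsto_atTop x (hx.resolve_left hxS))
  · by_cases hxS : x ∈ S
    · by_cases hxT : x ∈ T
      · exact (hf.tendsto_atBot x hxS).atBot_add_atBot (hg.tendsto_atBot x hxT)
      · exact (hf.tendsto_atBot x hxS).atBot_add (hlim hg nhdsWithin_le_nhds hxT)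
    · exact (hlim hf nhdsWithin_le_nhds hxS).add_atBot
        (hg.tendsto_atBot x (hx.resolve_left hxS))

theorem sum {ι : Type*} {s : Finset ι} {f : ι → ℝ → ℝ} {S : ι → Set ℝ} (hs : s.Nonempty)
    (h : ∀ i ∈ s, IsIncreasingOffPoles (f i) (S i)) :
    IsIncreasingOffPoles (fun x => ∑ i ∈ s, f i x) (⋃ i ∈ s, S i) := by
  induction hs using Finset.Nonempty.cons_induction with
  | singleton i => simpa using h i
  | cons i s hi _ ih =>
    rw [Finset.forall_mem_cons] at h
    simpa only [Finset.sum_cons, Finset.mem_cons, iUnion_iUnion_eq_or_left] using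
      h.1.add (ih h.2)

theorem strictMonoOn (hf : IsIncreasingOffPoles f S) (hS : Disjoint (Ioo u v) S) :
    StrictMonoOn f (Ioo u v) := by
  have hnotMem {x} (hx : x ∈ Ioo u v) : x ∉ S := disjoint_left.1 hS hx
  refine strictMonoOn_of_deriv_pos (convex_Ioo u v)
    (fun x hx => (hf.continuousAt (hnotMem hx)).continuousWithinAt) fun x hx => ?_
  obtain ⟨d, hd, hdf⟩ := hf.exists_hasDerivAt_pos x (hnotMem (interior_subset hx))
  rwa [hdf.deriv]

theorem surjOn (hf : IsIncreasingOffPoles f S) (hS : Disjoint (Ioo u v) S) (huv : u < v)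
    (hu : u ∈ S) (hv : v ∈ S) : SurjOn f (Ioo u v) univ := by
  have := left_nhdsWithin_Ioo_neBot huv
  have := right_nhdsWithin_Ioo_neBot huv
  refine isPreconnected_Ioo.intermediate_value_Iii (l₁ := 𝓝[Ioo u v] u) (l₂ := 𝓝[Ioo u v] v)
    inf_le_right inf_le_right
    (fun x hx => (hf.continuousAt (disjoint_left.1 hS hx)).continuousWithinAt) ?_ ?_
  · exact (hf.tendsto_atBot u hu).mono_left (nhdsWithin_mono _ Ioo_subset_Ioi_self)
  · exact (hf.tendsto_atTop v hv).mono_left (nhdsWithin_mono _ Ioo_subset_Iio_self)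

end IsIncreasingOffPoles

/-- `D` lists the poles of `f` in nondecreasing order, possibly with repetitions; there are
arbitrarily large and arbitrarily small poles, and `f` increases off them. -/
structure IsPoleEnumeration (f : ℝ → ℝ) (D : ℤ → ℝ) : Prop where
  monotone : Monotone D
  not_bddAbove : ¬ BddAbove (range D)
  not_bddBelow : ¬ BddBelow (range D)
  isIncreasingOffPoles : IsIncreasingOffPoles f (range D)

open Classical in
/-- The solution of `f x = y` between the consecutive poles `D k` and `D (k + 1)`; where the two
coincide, it is this repeated pole. -/
def levelBranch (f : ℝ → ℝ) (D : ℤ → ℝ) (y : ℝ) (k : ℤ) : ℝ :=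
  if D k < D (k + 1) then Function.invFunOn f (Ioo (D k) (D (k + 1))) y else D k

namespace IsPoleEnumeration

variable {f : ℝ → ℝ} {D : ℤ → ℝ} (h : IsPoleEnumeration f D) {x y : ℝ} {k : ℤ}

include h

theorem le_succ (k : ℤ) : D k ≤ D (k + 1) := h.monotone (lt_add_one k).le

theorem disjoint_gap (k : ℤ) : Disjoint (Ioo (D k) (D (k + 1))) (range D) := by
  rw [disjoint_right]
  rintro _ ⟨i, rfl⟩ ⟨hki, hik⟩
  have := h.monotone.reflect_lt hki
  have := h.monotone.reflect_lt hik
  omega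

theorem strictMonoOn_gap (k : ℤ) : StrictMonoOn f (Ioo (D k) (D (k + 1))) :=
  h.isIncreasingOffPoles.strictMonoOn (h.disjoint_gap k)

theorem exists_le_lt_succ (x : ℝ) : ∃ k, D k ≤ x ∧ x < D (k + 1) := by
  obtain ⟨_, ⟨i, rfl⟩, hi⟩ := not_bddBelow_iff.1 h.not_bddBelow x
  obtain ⟨_, ⟨l, rfl⟩, hl⟩ := not_bddAbove_iff.1 h.not_bddAbove x
  obtain ⟨k, hk, hmax⟩ := Int.exists_greatest_of_bdd (P := fun k => D k ≤ x)
    ⟨l, fun k hk => (h.monotone.reflect_lt (hk.trans_lt hl)).le⟩ ⟨i, hi.le⟩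
  exact ⟨k, hk, not_le.1 fun hle => (lt_add_one k).not_ge (hmax _ hle)⟩

theorem exists_mem_gap (hx : x ∉ range D) : ∃ k, x ∈ Ioo (D k) (D (k + 1)) :=
  let ⟨k, hk, hk'⟩ := h.exists_le_lt_succ x
  ⟨k, hk.lt_of_ne fun he => hx ⟨k, he⟩, hk'⟩

theorem levelBranch_mem_gap (y : ℝ) (hk : D k < D (k + 1)) :
    levelBranch f D y k ∈ Ioo (D k) (D (k + 1)) ∧ f (levelBranch f D y k) = y := by
  rw [levelBranch, if_pos hk]
  exact Function.invFunOn_pos (h.isIncreasingOffPoles.surjOn (h.disjoint_gap k) hk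
    (mem_range_self k) (mem_range_self (k + 1)) (mem_univ y))

theorem levelBranch_eq_iff (hx : x ∈ Ioo (D k) (D (k + 1))) :
    levelBranch f D y k = x ↔ f x = y := by
  obtain ⟨hmem, hval⟩ := h.levelBranch_mem_gap y (hx.1.trans hx.2)
  constructor
  · rintro rfl
    exact hval
  · intro hxy
    exact (h.strictMonoOn_gap k).injOn hmem hx (hval.trans hxy.symm)

theorem levelBranch_mem_Icc (y : ℝ) (k : ℤ) : levelBranch f D y k ∈ Icc (D k) (D (k + 1)) := by
  by_cases hk : D k < D (k + 1)
  · exact Ioo_subset_Icc_self (h.levelBranch_mem_gap y hk).1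
  · rw [levelBranch, if_neg hk]
    exact left_mem_Icc.2 (h.le_succ k)

theorem monotone_levelBranch (y : ℝ) : Monotone (levelBranch f D y) :=
  monotone_int_of_le_succ fun k =>
    (h.levelBranch_mem_Icc y k).2.trans (h.levelBranch_mem_Icc y (k + 1)).1

theorem strictMono_levelBranch (hk : D k < D (k + 1)) :
    StrictMono fun y => levelBranch f D y k := by
  intro y y' hy
  obtain ⟨hmem, hval⟩ := h.levelBranch_mem_gap y hk
  obtain ⟨hmem', hval'⟩ := h.levelBranch_mem_gap y' hk
  rwa [← hval, ← hval', (h.strictMonoOn_gap k).lt_iff_lt hmem hmem'] at hy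

theorem levelBranch_mono (k : ℤ) : Monotone fun y => levelBranch f D y k := by
  by_cases hk : D k < D (k + 1)
  · exact (h.strictMono_levelBranch hk).monotone
  · intro y y' _
    simp only [levelBranch, if_neg hk, le_refl]

theorem continuous_levelBranch (hk : D k < D (k + 1)) :
    Continuous fun y => levelBranch f D y k := by
  refine continuous_iff_continuousAt.2 fun y =>
    continuousAt_of_monotoneOn_of_image_mem_nhds ((h.levelBranch_mono k).monotoneOn _)
      univ_mem ?_
  filter_upwards [isOpen_Ioo.mem_nhds (h.levelBranch_mem_gap y hk).1] with x hx
  exact ⟨f x, mem_univ _, (h.levelBranch_eq_iff hx).2 rfl⟩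

theorem levelBranch_mem_range_iff :
    levelBranch f D y k ∈ range D ↔ D k = D (k + 1) := by
  constructor
  · intro hmem
    by_contra hne
    exact disjoint_left.1 (h.disjoint_gap k)
      (h.levelBranch_mem_gap y ((h.le_succ k).lt_of_ne hne)).1 hmem
  · intro heq
    rw [levelBranch, if_neg heq.not_lt]
    exact mem_range_self k

theorem encard_levelBranch_eq_of_mem_range (y : ℝ) (hx : x ∈ range D) :
    {k | levelBranch f D y k = x}.encard = {k | D k = x}.encard - 1 := by
  obtain ⟨K, hK, hK'⟩ := h.exists_le_lt_succ x
  have hDK : D K = x := by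
    obtain ⟨i, rfl⟩ := hx
    exact hK.antisymm (h.monotone (Int.lt_add_one_iff.1 (h.monotone.reflect_lt hK')))
  suffices {k | levelBranch f D y k = x} = {k | D k = x} \ {K} by
    rw [this, encard_sdiff_singleton_of_mem (show K ∈ {k | D k = x} from hDK)]
  ext k
  constructor
  · intro hk
    have heq : D k = D (k + 1) := h.levelBranch_mem_range_iff.1 (hk ▸ hx)
    have hDk : D k = x := by rwa [mem_ofPred_eq, levelBranch, if_neg heq.not_lt] at hk
    refine ⟨hDk, ?_⟩
    rintro rfl
    exact hK'.ne (hDk.symm.trans heq)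
  · rintro ⟨hDk, hkK⟩
    have hDk : D k = x := hDk
    have hlt : k < K :=
      (Int.lt_add_one_iff.1 (h.monotone.reflect_lt (hDk.trans_lt hK'))).lt_of_ne hkK
    have hle : D (k + 1) ≤ D k := (h.monotone hlt).trans (hK.trans hDk.ge)
    rwa [mem_ofPred_eq, levelBranch, if_neg hle.not_gt]

theorem encard_levelBranch_eq_of_notMem_range (hx : x ∉ range D) :
    {k | levelBranch f D y k = x}.encard = if f x = y then 1 else 0 := by
  obtain ⟨k, hk⟩ := h.exists_mem_gap hx
  have huniq {i} (hi : levelBranch f D y i = x) : i = k := by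
    obtain ⟨h₁, h₂⟩ := h.levelBranch_mem_Icc y i
    rw [hi] at h₁ h₂
    have := h.monotone.reflect_lt (h₁.trans_lt hk.2)
    have := h.monotone.reflect_lt (hk.1.trans_le h₂)
    omega
  split_ifs with hy
  · exact encard_eq_one.2 ⟨k, Subset.antisymm (fun _ => huniq)
      (singleton_subset_iff.2 ((h.levelBranch_eq_iff hk).2 hy))⟩
  · refine encard_eq_zero.2 (eq_empty_of_forall_notMem fun i hi => hy ?_)
    exact (h.levelBranch_eq_iff hk).1 (huniq hi ▸ hi)

theorem eq_levelBranch_of_continuousOn {X : Type*} [TopologicalSpace X] {I : Set X}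
    (hI : IsPreconnected I) {μ : X → ℝ} (hμ : ContinuousOn μ I)
    (havoid : ∀ τ ∈ I, μ τ ∉ range D) {τ₀ τ : X} (hτ₀ : τ₀ ∈ I)
    (hk : μ τ₀ ∈ Ioo (D k) (D (k + 1))) (hτ : τ ∈ I) :
    μ τ = levelBranch f D (f (μ τ)) k := by
  have hconn := (hI.image μ hμ).ordConnected
  have hpole (i : ℤ) : D i ∉ μ '' I := by
    rintro ⟨σ, hσ, hσi⟩
    exact havoid σ hσ ⟨i, hσi.symm⟩
  refine ((h.levelBranch_eq_iff ⟨?_, ?_⟩).2 rfl).symm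
  · exact not_le.1 fun hle => hpole k
      (hconn.out (mem_image_of_mem μ hτ) (mem_image_of_mem μ hτ₀) ⟨hle, hk.1.le⟩)
  · exact not_le.1 fun hle => hpole (k + 1)
      (hconn.out (mem_image_of_mem μ hτ₀) (mem_image_of_mem μ hτ) ⟨hk.2.le, hle⟩)

end IsPoleEnumeration

end IncreasingOffPoles

section Enumeration

theorem nonempty_orderIso_int_of_finite_Icc {α : Type*} [LinearOrder α] [NoMaxOrder α]
    [NoMinOrder α] [Nonempty α] (h : ∀ a b : α, (Icc a b).Finite) : Nonempty (α ≃o ℤ) := by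
  let _ : LocallyFiniteOrder α := LocallyFiniteOrder.ofFiniteIcc h
  let _ : SuccOrder α := LinearLocallyFiniteOrder.succOrder α
  let _ : PredOrder α := LinearLocallyFiniteOrder.predOrder α
  exact ⟨orderIsoIntOfLinearSuccPredArch⟩

variable {α ι : Type*} [LinearOrder α] [LinearOrder ι] {S : ι → Set α}

theorem finite_Icc_lex_subtype [Finite ι] (hfin : ∀ i a b, (S i ∩ Icc a b).Finite)
    (a b : {p : α ×ₗ ι // (ofLex p).1 ∈ S (ofLex p).2}) : (Icc a b).Finite := by
  have hf : (⋃ i, (fun x => toLex (x, i)) ''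
      (S i ∩ Icc (ofLex a.1).1 (ofLex b.1).1)).Finite :=
    finite_iUnion fun i => (hfin i _ _).image _
  refine Finite.of_finite_image (f := Subtype.val) (hf.subset ?_) Subtype.val_injective.injOn
  rintro _ ⟨p, hp, rfl⟩
  exact mem_iUnion.2 ⟨(ofLex p.1).2, (ofLex p.1).1,
    ⟨p.2, Prod.Lex.monotone_fst_ofLex hp.1, Prod.Lex.monotone_fst_ofLex hp.2⟩, rfl⟩

theorem exists_monotone_encard_eq [Finite ι] [Nonempty α]
    (hfin : ∀ i a b, (S i ∩ Icc a b).Finite) (habove : ¬ BddAbove (⋃ i, S i))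
    (hbelow : ¬ BddBelow (⋃ i, S i)) :
    ∃ D : ℤ → α, Monotone D ∧ ∀ x, {k | D k = x}.encard = {i | x ∈ S i}.encard := by
  let P := {p : α ×ₗ ι // (ofLex p).1 ∈ S (ofLex p).2}
  have : NoMaxOrder P := ⟨fun a => by
    obtain ⟨x, hx, hax⟩ := not_bddAbove_iff.1 habove (ofLex a.1).1
    obtain ⟨i, hi⟩ := mem_iUnion.1 hx
    exact ⟨⟨toLex (x, i), hi⟩, Prod.Lex.lt_iff.2 (Or.inl hax)⟩⟩
  have : NoMinOrder P := ⟨fun a => by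
    obtain ⟨x, hx, hxa⟩ := not_bddBelow_iff.1 hbelow (ofLex a.1).1
    obtain ⟨i, hi⟩ := mem_iUnion.1 hx
    exact ⟨⟨toLex (x, i), hi⟩, Prod.Lex.lt_iff.2 (Or.inl hxa)⟩⟩
  have : Nonempty P := by
    obtain ⟨x, hx⟩ := nonempty_of_not_bddAbove habove
    obtain ⟨i, hi⟩ := mem_iUnion.1 hx
    exact ⟨⟨toLex (x, i), hi⟩⟩
  obtain ⟨e⟩ := nonempty_orderIso_int_of_finite_Icc (finite_Icc_lex_subtype hfin)
  refine ⟨fun k => (ofLex (e.symm k).1).1, fun k l hkl =>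
    Prod.Lex.monotone_fst_ofLex (e.symm.monotone hkl), fun x => ?_⟩
  have hmem {k} (hk : (ofLex (e.symm k).1).1 = x) : x ∈ S (ofLex (e.symm k).1).2 :=
    hk ▸ (e.symm k).2
  exact encard_congr
    { toFun := fun k => ⟨(ofLex (e.symm k.1).1).2, hmem k.2⟩
      invFun := fun i => ⟨e ⟨toLex (x, i.1), i.2⟩, by simp⟩
      left_inv := by
        rintro ⟨k, rfl⟩
        exact Subtype.ext (e.apply_symm_apply k)
      right_inv := fun i => Subtype.ext (by simp) }

end Enumeration

namespace DiracStarGraph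

open scoped ComplexConjugate
open Filter Topology

variable {n : ℕ} (G : DiracStarGraph n) (j : Fin n)

section WeylFunction

theorem b_eq (z : ℂ) : G.b j z =
    Real.cos (G.α j) * G.col j 0 z (G.ℓ j) 0 + Real.sin (G.α j) * G.col j 0 z (G.ℓ j) 1 := by
  simp only [b, col]
  ring

theorem c_eq (z : ℂ) : G.c j z =
    Real.cos (G.α j) * G.col j 1 z (G.ℓ j) 0 + Real.sin (G.α j) * G.col j 1 z (G.ℓ j) 1 := by
  simp only [c, col]
  ring

theorem outerCondition_solution_iff (z : ℂ) (v : Fin 2 → ℂ) :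
    G.OuterCondition j (G.solution j z v) ↔ v 0 * G.b j z + v 1 * G.c j z = 0 := by
  rw [b_eq, c_eq, OuterCondition]
  simp only [solution, Pi.add_apply, Pi.smul_apply, smul_eq_mul]
  constructor <;> intro h <;> linear_combination h

theorem differentiable_b : Differentiable ℂ (G.b j) := by
  have h := G.differentiable_col j (right_mem_Icc.2 (G.ℓ_pos j).le) 0
  rw [funext (G.b_eq j)]
  exact ((h 0).const_mul _).add ((h 1).const_mul _)

theorem differentiable_c : Differentiable ℂ (G.c j) := by
  have h := G.differentiable_col j (right_mem_Icc.2 (G.ℓ_pos j).le) 1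
  rw [funext (G.c_eq j)]
  exact ((h 0).const_mul _).add ((h 1).const_mul _)

theorem b_conj (z : ℂ) : G.b j (conj z) = conj (G.b j z) := by
  have h := G.col_conj j 0 z (right_mem_Icc.2 (G.ℓ_pos j).le)
  rw [b_eq, b_eq, h, h]
  simp only [map_add, map_mul, Complex.conj_ofReal]

theorem c_conj (z : ℂ) : G.c j (conj z) = conj (G.c j z) := by
  have h := G.col_conj j 1 z (right_mem_Icc.2 (G.ℓ_pos j).le)
  rw [c_eq, c_eq, h, h]
  simp only [map_add, map_mul, Complex.conj_ofReal]

variable {G j} {z : ℂ}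

theorem b_ne_zero_of_c_eq_zero (hc : G.c j z = 0) : G.b j z ≠ 0 := by
  intro hb
  have hb' : G.OuterCondition j (G.col j 0 z) := (G.b_eq j z).symm.trans hb
  have hc' : G.OuterCondition j (G.col j 1 z) := (G.c_eq j z).symm.trans hc
  have h := hb'.wronskian_eq_zero hc'
  rw [wronskian_col z (right_mem_Icc.2 (G.ℓ_pos j).le)] at h
  exact neg_ne_zero.2 one_ne_zero h

variable (G j)

/-- The solution that satisfies the outer boundary condition, normalised so as to be entire
in `z`. -/
def outerSolution (z : ℂ) : ℝ → Fin 2 → ℂ := G.solution j z ![G.c j z, -G.b j z]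

theorem isSolution_outerSolution (z : ℂ) : G.IsSolution j z (G.outerSolution j z) :=
  G.isSolution_solution j z _

theorem outerSolution_zero (z : ℂ) : G.outerSolution j z 0 = ![G.c j z, -G.b j z] :=
  G.solution_zero j z _

theorem outerSolution_zero_ne_zero (z : ℂ) : G.outerSolution j z 0 ≠ 0 := by
  rw [outerSolution_zero]
  intro h
  have h0 : G.c j z = 0 := congrFun h 0
  have h1 : -G.b j z = 0 := congrFun h 1
  exact b_ne_zero_of_c_eq_zero h0 (neg_eq_zero.1 h1)

theorem outerCondition_outerSolution (z : ℂ) : G.OuterCondition j (G.outerSolution j z) := by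
  rw [outerSolution, outerCondition_solution_iff]
  simp only [cons_val_zero, cons_val_one]
  ring

theorem outerSolution_conj (z : ℂ) {x : ℝ} (hx : x ∈ Icc 0 (G.ℓ j)) (i : Fin 2) :
    G.outerSolution j (conj z) x i = conj (G.outerSolution j z x i) := by
  simp only [outerSolution, solution, Pi.add_apply, Pi.smul_apply, smul_eq_mul, cons_val_zero,
    cons_val_one, G.col_conj j _ z hx, b_conj, c_conj, map_add, map_mul, map_neg]

theorem exists_continuous_outerSolution :
    ∃ F : ℂ → C(Icc 0 (G.ℓ j), Fin 2 → ℂ), Continuous F ∧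
      ∀ z (x : Icc 0 (G.ℓ j)), F z x = G.outerSolution j z x := by
  choose u hu hcol using G.exists_differentiable_col j
  refine ⟨fun z => G.c j z • u 0 z + (-G.b j z) • u 1 z,
    ((G.differentiable_c j).continuous.smul (hu 0).continuous).add
      ((G.differentiable_b j).continuous.neg.smul (hu 1).continuous), fun z x => ?_⟩
  rw [outerSolution, solution, ← hcol, ← hcol]
  rfl

/-- The bilinear `L²` pairing of the normalised outer solutions at `z` and `w`. -/
def outerPairing (z w : ℂ) : ℂ :=
  ∫ t in (0 : ℝ)..G.ℓ j, (G.outerSolution j z t 0 * G.outerSolution j w t 0 +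
    G.outerSolution j z t 1 * G.outerSolution j w t 1)

theorem continuous_outerPairing (z : ℂ) : Continuous (G.outerPairing j z) := by
  have hℓ := (G.ℓ_pos j).le
  obtain ⟨F, hF, hFeq⟩ := G.exists_continuous_outerSolution j
  have hpairing : G.outerPairing j z = fun w => ∫ t in (0 : ℝ)..G.ℓ j,
      (F z (projIcc 0 (G.ℓ j) hℓ t) 0 * F w (projIcc 0 (G.ℓ j) hℓ t) 0 +
        F z (projIcc 0 (G.ℓ j) hℓ t) 1 * F w (projIcc 0 (G.ℓ j) hℓ t) 1) := by
    ext w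
    refine intervalIntegral.integral_congr fun t ht => ?_
    rw [uIcc_of_le hℓ] at ht
    simp only [hFeq, projIcc_of_mem hℓ ht]
  rw [hpairing]
  refine intervalIntegral.continuous_parametric_intervalIntegral_of_continuous' ?_ _ _
  have hproj : Continuous fun x : ℂ × ℝ => projIcc 0 (G.ℓ j) hℓ x.2 :=
    continuous_projIcc.comp continuous_snd
  have hw (i : Fin 2) : Continuous fun x : ℂ × ℝ => F x.1 (projIcc 0 (G.ℓ j) hℓ x.2) i :=
    (continuous_apply i).comp ((hF.comp continuous_fst).eval hproj)
  have hz (i : Fin 2) : Continuous fun x : ℂ × ℝ => F z (projIcc 0 (G.ℓ j) hℓ x.2) i :=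
    (continuous_apply i).comp ((F z).continuous.comp hproj)
  exact ((hz 0).mul (hw 0)).add ((hz 1).mul (hw 1))

theorem b_mul_c_sub_b_mul_c (z w : ℂ) :
    G.b j w * G.c j z - G.b j z * G.c j w = (w - z) * G.outerPairing j z w := by
  have h := (G.isSolution_outerSolution j z).wronskian_sub_wronskian_zero
    (G.isSolution_outerSolution j w) (right_mem_Icc.2 (G.ℓ_pos j).le)
  rw [(G.outerCondition_outerSolution j z).wronskian_eq_zero (G.outerCondition_outerSolution j w),
    wronskian, outerSolution_zero, outerSolution_zero] at h
  simp only [cons_val_zero, cons_val_one] at h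
  rw [outerPairing]
  linear_combination -h

theorem deriv_b_mul_c_sub (z : ℂ) :
    deriv (G.b j) z * G.c j z - G.b j z * deriv (G.c j) z = G.outerPairing j z z := by
  have hleft : HasDerivAt (fun w => G.b j w * G.c j z - G.b j z * G.c j w)
      (deriv (G.b j) z * G.c j z - G.b j z * deriv (G.c j) z) z :=
    ((G.differentiable_b j z).hasDerivAt.mul_const _).sub
      ((G.differentiable_c j z).hasDerivAt.const_mul _)
  refine hleft.unique (hasDerivAt_iff_tendsto_slope.2 ?_)
  refine (((G.continuous_outerPairing j z).tendsto z).mono_left nhdsWithin_le_nhds).congr' ?_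
  filter_upwards [self_mem_nhdsWithin] with w hw
  rw [slope_def_field, sub_self, sub_zero, b_mul_c_sub_b_mul_c,
    mul_div_cancel_left₀ _ (sub_ne_zero.2 hw)]

open scoped ComplexOrder in
theorem outerPairing_conj_pos (z : ℂ) : 0 < G.outerPairing j z (conj z) := by
  have hcont := (G.isSolution_outerSolution j z).continuousOn_apply
  have hnormSq : G.outerPairing j z (conj z) = (∫ t in (0 : ℝ)..G.ℓ j,
      (Complex.normSq (G.outerSolution j z t 0) + Complex.normSq (G.outerSolution j z t 1)) :) := by
    rw [outerPairing, ← intervalIntegral.integral_ofReal]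
    refine intervalIntegral.integral_congr fun t ht => ?_
    rw [uIcc_of_le (G.ℓ_pos j).le] at ht
    simp only [G.outerSolution_conj j z ht, Complex.mul_conj, Complex.ofReal_add]
  rw [hnormSq, Complex.zero_lt_real]
  refine intervalIntegral.integral_pos (G.ℓ_pos j)
    ((Complex.continuous_normSq.comp_continuousOn (hcont 0)).add
      (Complex.continuous_normSq.comp_continuousOn (hcont 1)))
    (fun t _ => add_nonneg (Complex.normSq_nonneg _) (Complex.normSq_nonneg _))
    ⟨0, left_mem_Icc.2 (G.ℓ_pos j).le, ?_⟩
  obtain ⟨i, hi⟩ := Function.ne_iff.1 (G.outerSolution_zero_ne_zero j z)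
  have hi := Complex.normSq_pos.2 hi
  fin_cases i
  · exact add_pos_of_pos_of_nonneg hi (Complex.normSq_nonneg _)
  · exact add_pos_of_nonneg_of_pos (Complex.normSq_nonneg _) hi

variable {G j}

open scoped ComplexOrder in
theorem im_eq_zero_of_c_eq_zero (hc : G.c j z = 0) : z.im = 0 := by
  have h := G.b_mul_c_sub_b_mul_c j z (conj z)
  rw [hc, c_conj, hc, map_zero, mul_zero, mul_zero, sub_zero] at h
  have hz := (mul_eq_zero.1 h.symm).resolve_right (G.outerPairing_conj_pos j z).ne'
  exact Complex.conj_eq_iff_im.1 (sub_eq_zero.1 hz)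

open scoped ComplexOrder in
theorem im_mul_im_m_pos (hz : z.im ≠ 0) : 0 < z.im * (G.m j z).im := by
  have hc : 0 < Complex.normSq (G.c j z) := Complex.normSq_pos.2 (mt im_eq_zero_of_c_eq_zero hz)
  obtain ⟨hre, him⟩ := Complex.lt_def.1 (G.outerPairing_conj_pos j z)
  have hbc : (G.b j z).im * (G.c j z).re - (G.b j z).re * (G.c j z).im =
      z.im * (G.outerPairing j z (conj z)).re := by
    have h := congrArg Complex.im (G.b_mul_c_sub_b_mul_c j z (conj z))
    simp only [b_conj, c_conj, Complex.sub_im, Complex.mul_im, Complex.sub_re, Complex.conj_re,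
      Complex.conj_im, ← him, Complex.zero_im] at h
    linarith
  rw [m, Complex.div_im, ← sub_div, hbc, ← mul_div_assoc, ← mul_assoc]
  exact div_pos (mul_pos (mul_self_pos.2 hz) hre) hc

variable (G j)

theorem preimage_c_mem_codiscrete : G.c j ⁻¹' {0}ᶜ ∈ codiscrete ℂ :=
  AnalyticOnNhd.preimage_zero_mem_codiscrete (x := Complex.I)
    (fun w _ => (G.differentiable_c j).analyticAt w)
    (mt im_eq_zero_of_c_eq_zero one_ne_zero)

variable {G j}

theorem isPole_iff : G.IsPole j z ↔ G.c j z = 0 := by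
  have hb := (G.differentiable_b j).analyticAt z
  have hc := (G.differentiable_c j).analyticAt z
  refine ⟨fun h => by_contra fun hne => h.not_ge (hb.div hc hne).meromorphicOrderAt_nonneg,
    fun h => ?_⟩
  refine (tendsto_cobounded_iff_meromorphicOrderAt_neg
    (hb.meromorphicAt.div hc.meromorphicAt)).1 ?_
  rw [← tendsto_norm_atTop_iff_cobounded]
  have hctendsto : Tendsto (fun w => ‖G.c j w‖) (𝓝[≠] z) (𝓝[>] 0) := by
    refine tendsto_nhdsWithin_iff.2 ⟨?_, ?_⟩
    · have h0 := (hc.continuousAt.norm.tendsto).mono_left (nhdsWithin_le_nhds (s := {z}ᶜ))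
      rwa [h, norm_zero] at h0
    · have hne := mem_codiscreteWithin_iff_forall_mem_nhdsNE.1 (G.preimage_c_mem_codiscrete j) z
        (mem_univ z)
      rw [compl_univ, union_empty] at hne
      filter_upwards [hne] with w hw using norm_pos_iff.2 hw
  have hbtendsto := (hb.continuousAt.norm.tendsto).mono_left (nhdsWithin_le_nhds (s := {z}ᶜ))
  refine (hbtendsto.pos_mul_atTop (norm_pos_iff.2 (b_ne_zero_of_c_eq_zero h))
    hctendsto.inv_tendsto_nhdsGT_zero).congr fun w => ?_
  rw [Pi.div_apply, norm_div, div_eq_mul_inv, Pi.inv_apply]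

variable (G j)

/-- The restriction of `m_j` to the real axis. -/
def mReal (x : ℝ) : ℝ := (G.m j x).re

theorem ofReal_re_eq_of_conj_eq {f : ℂ → ℂ} (hf : ∀ z, f (conj z) = conj (f z)) (x : ℝ) :
    ((f x).re : ℂ) = f x :=
  Complex.conj_eq_iff_re.1 (by rw [← hf, Complex.conj_ofReal])

theorem m_conj (z : ℂ) : G.m j (conj z) = conj (G.m j z) := by
  rw [m, m, b_conj, c_conj, map_div₀]

theorem ofReal_mReal (x : ℝ) : (G.mReal j x : ℂ) = G.m j x :=
  ofReal_re_eq_of_conj_eq (G.m_conj j) x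

theorem isIncreasingOffPoles_mReal :
    IsIncreasingOffPoles (G.mReal j) {x : ℝ | G.c j x = 0} := by
  have hb (x : ℝ) : ((G.b j x).re : ℂ) = G.b j x := ofReal_re_eq_of_conj_eq (G.b_conj j) x
  have hc (x : ℝ) : ((G.c j x).re : ℂ) = G.c j x := ofReal_re_eq_of_conj_eq (G.c_conj j) x
  have hquot : G.mReal j = fun x : ℝ => (G.b j x).re / (G.c j x).re := by
    ext x
    rw [mReal, m, ← hb, ← hc, ← Complex.ofReal_div, Complex.ofReal_re]
    rfl
  have hzeros : {x : ℝ | G.c j x = 0} = {x : ℝ | (G.c j x).re = 0} := by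
    ext x
    exact (hc x ▸ Complex.ofReal_eq_zero :)
  rw [hquot, hzeros]
  refine .of_div (fun x => (G.differentiable_b j x).hasDerivAt.real_of_complex)
    (fun x => (G.differentiable_c j x).hasDerivAt.real_of_complex) fun x => ?_
  have hpos := (Complex.lt_def.1 (G.outerPairing_conj_pos j x)).1
  rw [Complex.conj_ofReal, ← G.deriv_b_mul_c_sub j x, ← hb, ← hc] at hpos
  simpa using hpos

theorem finite_setOf_c_eq_zero_inter_Icc (u v : ℝ) :
    ({x : ℝ | G.c j x = 0} ∩ Icc u v).Finite := by
  have hmem : G.c j ⁻¹' {0}ᶜ ∈ codiscreteWithin (Complex.ofReal '' Icc u v) :=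
    codiscreteWithin_mono (subset_univ _) (G.preimage_c_mem_codiscrete j)
  have hfin := (isCompact_Icc.image Complex.continuous_ofReal).finite_sdiff_of_mem_codiscreteWithin
    hmem
  refine Finite.of_finite_image (hfin.subset ?_) Complex.ofReal_injective.injOn
  rintro _ ⟨x, ⟨hx, hxI⟩, rfl⟩
  exact ⟨mem_image_of_mem _ hxI, fun h => h hx⟩

end WeylFunction

end DiracStarGraph

section PruferPhase

theorem absolutelyContinuousOnInterval_cexp {f : ℝ → ℂ} {a b : ℝ}
    (hf : AbsolutelyContinuousOnInterval f a b) :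
    AbsolutelyContinuousOnInterval (fun x => Complex.exp (f x)) a b := by
  obtain ⟨C, hC⟩ := hf.exists_bound
  obtain ⟨K, hK⟩ := (Complex.contDiff_exp (𝕜 := ℝ) (n := 1)).contDiffOn.exists_lipschitzOnWith
    one_ne_zero (convex_closedBall (0 : ℂ) C) (isCompact_closedBall _ _)
  exact absolutelyContinuousOnInterval_of_dist_le K hf fun x hx y hy =>
    hK.dist_le_mul _ (mem_closedBall_zero_iff.2 (hC x hx)) _ (mem_closedBall_zero_iff.2 (hC y hy))

theorem eq_mul_exp_integral {f k : ℝ → ℂ} {a b : ℝ} (hf : AbsolutelyContinuousOnInterval f a b)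
    (hk : IntervalIntegrable k volume a b)
    (h : ∀ᵐ x, x ∈ uIcc a b → HasDerivAt f (k x * f x) x) :
    f b = f a * Complex.exp (∫ x in a..b, k x) := by
  have hexp := absolutelyContinuousOnInterval_cexp (absolutelyContinuousOnInterval_integral hk).neg
  obtain ⟨C, hC⟩ := (hf.fun_smul hexp).const_of_ae_hasDerivAt_zero (by
    filter_upwards [h, hk.ae_hasDerivAt_integral] with x hfx hkx hx
    refine ((hfx hx).mul (hkx hx a left_mem_uIcc).neg.cexp).congr_deriv ?_
    simp only [Pi.neg_apply]
    ring)
  have ha := hC a left_mem_uIcc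
  have hb := hC b right_mem_uIcc
  simp only [smul_eq_mul, Pi.neg_apply, intervalIntegral.integral_same, neg_zero,
    Complex.exp_zero, mul_one] at ha hb
  rw [ha, ← hb, mul_assoc, ← Complex.exp_add, neg_add_cancel, Complex.exp_zero, mul_one]

end PruferPhase

namespace DiracStarGraph

open scoped ComplexConjugate
open Filter

variable {n : ℕ} (G : DiracStarGraph n) (j : Fin n) {t : ℝ}

section PruferPhase

/-- The Prüfer variable `f + i f̂` of the second column `(f, f̂)` of the fundamental matrix. -/
def prufer (s t : ℝ) : ℂ := G.col j 1 s t 0 + Complex.I * G.col j 1 s t 1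

/-- The potential `q - i p`, which enters the equation `F' = i s F + (q - i p) F̄` of the Prüfer
variable `F`. -/
def complexPotential (t : ℝ) : ℂ := G.q j t - Complex.I * G.p j t

/-- The deviation of the logarithmic derivative of the Prüfer variable from its value `i s` for the
zero potential. -/
def phaseIntegrand (s t : ℝ) : ℂ :=
  G.complexPotential j t * (conj (G.prufer j s t) / G.prufer j s t)

theorem conj_prufer (s : ℝ) (ht : t ∈ Icc 0 (G.ℓ j)) :
    conj (G.prufer j s t) = G.col j 1 s t 0 - Complex.I * G.col j 1 s t 1 := by
  have hreal (i : Fin 2) : conj (G.col j 1 s t i) = G.col j 1 s t i := by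
    rw [← G.col_conj j 1 s ht i, Complex.conj_ofReal]
  rw [prufer, map_add, map_mul, hreal, hreal, Complex.conj_I, neg_mul, sub_eq_add_neg]

theorem prufer_ne_zero (s : ℝ) (ht : t ∈ Icc 0 (G.ℓ j)) : G.prufer j s t ≠ 0 := by
  intro h
  have hconj := G.conj_prufer j s ht
  rw [h, map_zero] at hconj
  rw [prufer] at h
  have h0 : G.col j 1 s t 0 = 0 := by linear_combination (h - hconj) / 2
  have h1 : G.col j 1 s t 1 = 0 := by
    linear_combination (-Complex.I / 2) * (h + hconj) + G.col j 1 s t 1 * Complex.I_sq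
  have hw : wronskian (G.col j 0 s) (G.col j 1 s) t = -1 := wronskian_col _ ht
  simp [wronskian, h0, h1] at hw

theorem continuousOn_prufer (s : ℝ) : ContinuousOn (G.prufer j s) (Icc 0 (G.ℓ j)) :=
  ((G.isSolution_col j 1 s).continuousOn_apply 0).add
    (continuousOn_const.mul ((G.isSolution_col j 1 s).continuousOn_apply 1))

theorem continuous_prufer (ht : t ∈ Icc 0 (G.ℓ j)) : Continuous fun s => G.prufer j s t := by
  have h (i : Fin 2) := (G.differentiable_col j ht 1 i).continuous.comp Complex.continuous_ofReal
  exact (h 0).add (continuous_const.mul (h 1))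

theorem intervalIntegrable_complexPotential :
    IntervalIntegrable (G.complexPotential j) volume 0 (G.ℓ j) :=
  (G.intervalIntegrable_q j).sub ((G.intervalIntegrable_p j).const_mul _)

theorem intervalIntegrable_phaseIntegrand (s : ℝ) :
    IntervalIntegrable (G.phaseIntegrand j s) volume 0 (G.ℓ j) := by
  refine (G.intervalIntegrable_complexPotential j).mul_continuousOn ?_
  rw [uIcc_of_le (G.ℓ_pos j).le]
  exact (Complex.continuous_conj.comp_continuousOn (G.continuousOn_prufer j s)).div
    (G.continuousOn_prufer j s) fun t ht => G.prufer_ne_zero j s ht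

theorem norm_phaseIntegrand_le (s t : ℝ) :
    ‖G.phaseIntegrand j s t‖ ≤ ‖G.complexPotential j t‖ := by
  rw [phaseIntegrand, norm_mul, norm_div, Complex.norm_conj]
  exact mul_le_of_le_one_right (norm_nonneg _) (div_self_le_one _)

theorem prufer_outer (s : ℝ) : G.prufer j s (G.ℓ j) =
    Complex.I * Complex.exp (∫ t in (0 : ℝ)..G.ℓ j, (Complex.I * s + G.phaseIntegrand j s t)) := by
  have hcol := G.isSolution_col j 1 s
  have hac : AbsolutelyContinuousOnInterval (G.prufer j s) 0 (G.ℓ j) :=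
    (absolutelyContinuousOnInterval_apply hcol.1 0).add
      ((absolutelyContinuousOnInterval_apply hcol.1 1).const_smul Complex.I)
  have h0 : G.prufer j s 0 = Complex.I := by simp [prufer, col_zero]
  rw [← h0]
  refine h0 ▸ eq_mul_exp_integral hac
    (intervalIntegrable_const.add (G.intervalIntegrable_phaseIntegrand j s)) ?_
  filter_upwards [hcol.ae_hasDerivAt] with t hderiv ht
  have hderiv := hasDerivAt_pi.1 (hderiv ht)
  rw [uIcc_of_le (G.ℓ_pos j).le] at ht
  refine ((hderiv 0).add ((hderiv 1).const_mul Complex.I)).congr_deriv ?_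
  rw [phaseIntegrand, add_mul, mul_assoc (G.complexPotential j t),
    div_mul_cancel₀ _ (G.prufer_ne_zero j s ht), conj_prufer G j s ht, prufer, complexPotential]
  simp only [potentialCoef_add_smul_spectralCoef_apply, cons_val_zero, cons_val_one]
  linear_combination (-(s : ℂ) * G.col j 1 s t 1 - G.p j t * G.col j 1 s t 1) * Complex.I_sq

/-- The Prüfer phase of the second column at the outer vertex, relative to the outer boundary
condition. -/
def phase (s : ℝ) : ℝ := (∫ t in (0 : ℝ)..G.ℓ j, G.phaseIntegrand j s t).im + G.ℓ j * s - G.α j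

theorem continuous_phase : Continuous (G.phase j) := by
  refine ((Complex.continuous_im.comp ?_).add (continuous_const.mul continuous_id)).sub
    continuous_const
  have hsub : uIoc 0 (G.ℓ j) ⊆ Icc 0 (G.ℓ j) := by
    rw [uIoc_of_le (G.ℓ_pos j).le]
    exact Ioc_subset_Icc_self
  refine intervalIntegral.continuous_of_dominated_interval
    (fun s => (intervalIntegrable_iff.1 (G.intervalIntegrable_phaseIntegrand j s)).1)
    (fun s => .of_forall fun t _ => G.norm_phaseIntegrand_le j s t)
    (G.intervalIntegrable_complexPotential j).norm (.of_forall fun t ht => ?_)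
  exact continuous_const.mul ((Complex.continuous_conj.comp (G.continuous_prufer j (hsub ht))).div
    (G.continuous_prufer j (hsub ht)) fun s => G.prufer_ne_zero j s (hsub ht))

theorem exists_abs_phase_sub_le : ∃ K, ∀ s, |G.phase j s - G.ℓ j * s| ≤ K := by
  refine ⟨(∫ t in (0 : ℝ)..G.ℓ j, ‖G.complexPotential j t‖) + |G.α j|, fun s => ?_⟩
  have h : G.phase j s - G.ℓ j * s =
      (∫ t in (0 : ℝ)..G.ℓ j, G.phaseIntegrand j s t).im - G.α j := by
    rw [phase]
    ring
  rw [h]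
  refine (abs_sub _ _).trans (add_le_add_left ((Complex.abs_im_le_norm _).trans ?_) _)
  exact intervalIntegral.norm_integral_le_of_norm_le (G.ℓ_pos j).le
    (.of_forall fun t _ => G.norm_phaseIntegrand_le j s t)
    (G.intervalIntegrable_complexPotential j).norm

theorem tendsto_phase_atTop : Tendsto (G.phase j) atTop atTop := by
  obtain ⟨K, hK⟩ := G.exists_abs_phase_sub_le j
  refine tendsto_atTop_mono (fun s => ?_)
    (tendsto_atTop_add_const_right _ (-K) (tendsto_id.const_mul_atTop (G.ℓ_pos j)))
  simp only [id]
  linarith [(abs_le.1 (hK s)).1]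

theorem tendsto_phase_atBot : Tendsto (G.phase j) atBot atBot := by
  obtain ⟨K, hK⟩ := G.exists_abs_phase_sub_le j
  refine tendsto_atBot_mono (fun s => ?_)
    (tendsto_atBot_add_const_right _ K (tendsto_id.const_mul_atBot (G.ℓ_pos j)))
  simp only [id]
  linarith [(abs_le.1 (hK s)).2]

theorem ofReal_re_prufer_mul_exp (s : ℝ) :
    ((G.prufer j s (G.ℓ j) * Complex.exp (-(G.α j) * Complex.I)).re : ℂ) = G.c j s := by
  rw [Complex.re_eq_add_conj, map_mul, G.conj_prufer j s (right_mem_Icc.2 (G.ℓ_pos j).le),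
    ← Complex.exp_conj, c_eq, prufer]
  have hconj : conj (-(G.α j : ℂ) * Complex.I) = G.α j * Complex.I := by simp
  rw [hconj, Complex.exp_mul_I, Complex.exp_mul_I, Complex.cos_neg, Complex.sin_neg,
    Complex.ofReal_cos, Complex.ofReal_sin]
  linear_combination (-Complex.sin (G.α j) * G.col j 1 s (G.ℓ j) 1) * Complex.I_sq

theorem c_eq_zero_of_sin_phase_eq_zero {s : ℝ} (h : Real.sin (G.phase j s) = 0) :
    G.c j s = 0 := by
  have hphase : ((∫ t in (0 : ℝ)..G.ℓ j, (Complex.I * s + G.phaseIntegrand j s t)) +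
      -(G.α j) * Complex.I).im = G.phase j s := by
    rw [intervalIntegral.integral_add intervalIntegrable_const
      (G.intervalIntegrable_phaseIntegrand j s), intervalIntegral.integral_const, phase]
    simp
    ring
  rw [← ofReal_re_prufer_mul_exp, prufer_outer, mul_assoc, ← Complex.exp_add, Complex.I_mul_re,
    Complex.exp_im, hphase, h, mul_zero, neg_zero, Complex.ofReal_zero]

theorem not_bddAbove_setOf_c_eq_zero : ¬ BddAbove {x : ℝ | G.c j x = 0} := by
  refine not_bddAbove_iff.2 fun N => ?_
  obtain ⟨k, hk⟩ := exists_int_ge (G.phase j (N + 1) / Real.pi)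
  obtain ⟨x, hx, hphase⟩ := intermediate_value_Ici (G.continuous_phase j).continuousOn
    (G.tendsto_phase_atTop j) ((div_le_iff₀ Real.pi_pos).1 hk)
  exact ⟨x, G.c_eq_zero_of_sin_phase_eq_zero j (by rw [hphase, Real.sin_int_mul_pi]),
    (lt_add_one N).trans_le hx⟩

theorem not_bddBelow_setOf_c_eq_zero : ¬ BddBelow {x : ℝ | G.c j x = 0} := by
  refine not_bddBelow_iff.2 fun N => ?_
  obtain ⟨k, hk⟩ := exists_int_le (G.phase j (N - 1) / Real.pi)
  obtain ⟨x, hx, hphase⟩ := intermediate_value_Iic (G.continuous_phase j).continuousOn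
    (G.tendsto_phase_atBot j) ((le_div_iff₀ Real.pi_pos).1 hk)
  exact ⟨x, G.c_eq_zero_of_sin_phase_eq_zero j (by rw [hphase, Real.sin_int_mul_pi]),
    lt_of_le_of_lt hx (sub_one_lt N)⟩

end PruferPhase

end DiracStarGraph

section Multiplicity

variable {E F : Type*} [AddCommGroup E] [Module ℂ E] [AddCommGroup F] [Module ℂ F]

theorem mem_map_subtype_eigenKer_iff (A : E →ₗ.[ℂ] E) (z : ℂ) (u : E) :
    u ∈ (A.eigenKer z).map A.domain.subtype ↔ (u, z • u) ∈ A.graph := by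
  simp only [LinearPMap.eigenKer, Submodule.mem_map, LinearMap.mem_ker, LinearMap.sub_apply,
    LinearMap.smul_apply, sub_eq_zero, Submodule.subtype_apply, LinearPMap.mem_graph_iff]
  constructor
  · rintro ⟨y, hy, rfl⟩
    exact ⟨y, rfl, hy⟩
  · rintro ⟨y, rfl, hy⟩
    exact ⟨y, hy, rfl⟩

theorem multiplicity_eq_finrank_comap_graph [FiniteDimensional ℂ F] (A : E →ₗ.[ℂ] E) (z : ℂ)
    {e : F →ₗ[ℂ] E} (he : Function.Injective e)
    (hrange : ∀ u, (u, z • u) ∈ A.graph → u ∈ LinearMap.range e) :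
    A.multiplicity z = Module.finrank ℂ (A.graph.comap (e.prod (z • e))) := by
  set K := A.graph.comap (e.prod (z • e))
  have hK : (A.eigenKer z).map A.domain.subtype = K.map e := by
    ext u
    rw [mem_map_subtype_eigenKer_iff]
    constructor
    · intro hu
      obtain ⟨a, rfl⟩ := hrange u hu
      exact ⟨a, hu, rfl⟩
    · rintro ⟨a, ha, rfl⟩
      exact ha
  let equiv := (Submodule.equivMapOfInjective A.domain.subtype Subtype.val_injective
    (A.eigenKer z)).trans ((LinearEquiv.ofEq _ _ hK).trans
      (Submodule.equivMapOfInjective e he K).symm)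
  have hrank := equiv.lift_rank_eq
  rw [← Module.finrank_eq_rank ℂ K, Cardinal.lift_natCast, Cardinal.lift_eq_nat_iff] at hrank
  rw [LinearPMap.multiplicity, hrank, map_natCast]

theorem isEigenvalue_iff_multiplicity_ne_zero (A : E →ₗ.[ℂ] E) (z : ℂ) :
    A.IsEigenvalue z ↔ A.multiplicity z ≠ 0 := by
  rw [LinearPMap.IsEigenvalue, LinearPMap.multiplicity, ne_eq, ne_eq, Cardinal.toENat_eq_zero,
    Submodule.rank_eq_zero]

end Multiplicity

namespace DiracStarGraph

variable {n : ℕ} (G : DiracStarGraph n)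

theorem memLp_col (j : Fin n) (k i : Fin 2) (z : ℂ) :
    MemLp (fun x => G.col j k z x i) 2 (G.μ j) := by
  have hcont := (G.isSolution_col j k z).continuousOn_apply i
  obtain ⟨C, hC⟩ := isCompact_Icc.exists_bound_of_continuousOn hcont
  exact MemLp.of_bound (hcont.aestronglyMeasurable measurableSet_Icc) C
    (ae_restrict_of_forall_mem measurableSet_Icc hC)

/-- The element of `L²(G)` that consists on each edge `e_j` of the solution of `H_j f = z f` with
value `a j` at the central vertex. -/
def solutionLp (z : ℂ) : (Fin n → Fin 2 → ℂ) →ₗ[ℂ] G.H where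
  toFun a := WithLp.toLp 2 fun j => WithLp.toLp 2 fun i =>
    a j 0 • (G.memLp_col j 0 i z).toLp + a j 1 • (G.memLp_col j 1 i z).toLp
  map_add' a a' := by
    ext1 j
    ext1 i
    simp only [Pi.add_apply, add_smul, PiLp.add_apply]
    abel
  map_smul' r a := by
    ext1 j
    ext1 i
    simp only [Pi.smul_apply, smul_assoc, PiLp.smul_apply, RingHom.id_apply, smul_add]

theorem coeFn_solutionLp (z : ℂ) (a : Fin n → Fin 2 → ℂ) (j : Fin n) (i : Fin 2) :
    (G.solutionLp z a j i : ℝ → ℂ) =ᵐ[G.μ j] fun x => G.solution j z (a j) x i := by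
  have hcol (k : Fin 2) : (a j k • (G.memLp_col j k i z).toLp : Lp ℂ 2 (G.μ j)) =ᵐ[G.μ j]
      fun x => a j k * G.col j k z x i :=
    (Lp.coeFn_smul _ _).trans ((G.memLp_col j k i z).coeFn_toLp.const_smul (a j k))
  exact (Lp.coeFn_add _ _).trans ((hcol 0).add (hcol 1))

theorem solutionLp_injective (z : ℂ) : Function.Injective (G.solutionLp z) := by
  refine (injective_iff_map_eq_zero _).2 fun a ha => ?_
  ext j i
  have hsol := G.coeFn_solutionLp z a j i
  rw [ha] at hsol
  have heq := Measure.eqOn_Icc_of_ae_eq volume (G.ℓ_pos j).ne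
    (hsol.symm.trans (Lp.coeFn_zero ℂ 2 (G.μ j)))
    ((G.isSolution_solution j z (a j)).continuousOn_apply i) continuousOn_const
    (left_mem_Icc.2 (G.ℓ_pos j).le)
  exact (congrFun (G.solution_zero j z (a j)) i).symm.trans heq

variable {G} {τ : EReal} {z : ℂ} {u : G.H} {f : Fin n → ℝ → Fin 2 → ℂ}

theorem IsRobinPair.isSolution (h : G.IsRobinPair τ u (z • u) f) (j : Fin n) :
    G.IsSolution j z (f j) := by
  obtain ⟨hac, hu, hzu, -, -⟩ := h
  refine ⟨hac j, ?_⟩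
  filter_upwards [ae_all_iff.2 (hu j), ae_all_iff.2 (hzu j),
    ae_all_iff.2 fun i => Lp.coeFn_smul z (u j i)] with x hux hzux hsmul
  ext i
  exact (hzux i).symm.trans ((hsmul i).trans (congrArg (z * ·) (hux i)))

theorem IsRobinPair.eq_solutionLp (h : G.IsRobinPair τ u (z • u) f) :
    u = G.solutionLp z fun j => f j 0 := by
  ext1 j
  ext1 i
  refine Lp.ext ?_
  filter_upwards [G.coeFn_solutionLp z (fun j => f j 0) j i, h.2.1 j i, G.ae_Ioo j]
    with x hsol hux hx
  rw [hsol, hux, (h.isSolution j).eqOn_solution (Ioo_subset_Icc_self hx)]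

variable (G)

/-- The values at the central vertex of the eigenfunctions of `T_τ` to the eigenvalue `z`, which
determine the eigenfunctions. -/
def vertexData (τ : EReal) (z : ℂ) : Submodule ℂ (Fin n → Fin 2 → ℂ) :=
  (G.T τ).graph.comap ((G.solutionLp z).prod (z • G.solutionLp z))

theorem multiplicity_T (τ : EReal) (z : ℂ) :
    (G.T τ).multiplicity z = Module.finrank ℂ (G.vertexData τ z) := by
  refine multiplicity_eq_finrank_comap_graph _ z (G.solutionLp_injective z) fun u hu => ?_
  rw [T_graph] at hu
  obtain ⟨f, hf⟩ := hu
  exact ⟨_, hf.eq_solutionLp.symm⟩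

variable {G} {a : Fin n → Fin 2 → ℂ}

theorem mem_vertexData_iff : a ∈ G.vertexData τ z ↔
    (∀ j, a j 0 * G.b j z + a j 1 * G.c j z = 0) ∧ RobinCondition τ fun j _ => a j := by
  rw [vertexData, Submodule.mem_comap, T_graph]
  constructor
  · rintro ⟨f, hf⟩
    obtain rfl : a = fun j => f j 0 := G.solutionLp_injective z hf.eq_solutionLp
    have hsol := hf.isSolution
    obtain ⟨-, -, -, houter, hrobin⟩ := hf
    refine ⟨fun j => ?_, hrobin⟩
    rw [← outerCondition_solution_iff, OuterCondition,
      ← (hsol j).eqOn_solution (right_mem_Icc.2 (G.ℓ_pos j).le)]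
    exact houter j
  · rintro ⟨houter, hrobin⟩
    refine ⟨fun j => G.solution j z (a j), fun j => (G.isSolution_solution j z _).1,
      G.coeFn_solutionLp z a, fun j i => ?_,
      fun j => (G.outerCondition_solution_iff j z (a j)).2 (houter j), ?_⟩
    · filter_upwards [G.coeFn_solutionLp z a j i, Lp.coeFn_smul z (G.solutionLp z a j i),
        (G.isSolution_solution j z (a j)).2] with x hsol hsmul hdirac
      refine hsmul.trans ?_
      rw [hdirac, Pi.smul_apply, hsol, Pi.smul_apply]
    · simpa only [RobinCondition, solution_zero] using hrobin

theorem robinCondition_zero_iff : RobinCondition 0 f ↔ ∀ j, f j 0 0 = 0 := by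
  simp only [RobinCondition, EReal.zero_ne_top, EReal.zero_ne_bot, EReal.toReal_zero, ne_eq,
    not_false_eq_true, and_self, forall_const, Complex.ofReal_zero, zero_mul, or_self,
    false_imp_iff, and_true]
  exact and_iff_right_of_imp fun h j k => (h j).trans (h k).symm

theorem robinCondition_iff (hτ : τ ≠ 0) (i : Fin n) : RobinCondition τ f ↔
    (∀ j, f j 0 0 = f i 0 0) ∧ ((τ⁻¹).toReal : ℂ) * f i 0 0 = ∑ k, f k 0 1 := by
  have hcont : (∀ j k, f j 0 0 = f k 0 0) ↔ ∀ j, f j 0 0 = f i 0 0 :=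
    ⟨fun h j => h j i, fun h j k => (h j).trans (h k).symm⟩
  rw [RobinCondition, hcont]
  refine and_congr_right fun hi => ?_
  simp only [hi]
  induction τ with
  | bot => simp [eq_comm]
  | top => simp [eq_comm]
  | coe r =>
    have hr : (r : ℂ) ≠ 0 := Complex.ofReal_ne_zero.2 fun h => hτ (h ▸ EReal.coe_zero)
    have : Nonempty (Fin n) := ⟨i⟩
    simp only [ne_eq, EReal.coe_ne_top, EReal.coe_ne_bot, not_false_eq_true, and_self,
      forall_const, EReal.toReal_coe, or_self, false_imp_iff, and_true, ← EReal.coe_inv,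
      Complex.ofReal_inv]
    exact (inv_mul_eq_iff_eq_mul₀ hr).symm

section DirichletData

variable {ι : Type*} {P : Set ι}

/-- The central vertex data `(0, x_j)` on the edges `j ∈ P` and `(0, 0)` on the other edges. -/
def dirichletData (P : Set ι) : (P → ℂ) →ₗ[ℂ] (ι → Fin 2 → ℂ) :=
  LinearMap.pi (fun j => LinearMap.single ℂ (fun _ => ℂ) 1 ∘ₗ LinearMap.proj j) ∘ₗ
    Function.ExtendByZero.linearMap ℂ Subtype.val

theorem dirichletData_apply (x : P → ℂ) (j : ι) :
    dirichletData P x j = ![0, Function.extend Subtype.val x 0 j] := by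
  ext i
  fin_cases i <;> simp [dirichletData]

theorem injective_dirichletData : Function.Injective (dirichletData P) := by
  intro x y h
  ext j
  simpa [dirichletData_apply, Subtype.val_injective.extend_apply] using
    congrFun (congrFun h j) 1

theorem mem_range_dirichletData_iff {a : ι → Fin 2 → ℂ} :
    a ∈ LinearMap.range (dirichletData P) ↔ (∀ j, a j 0 = 0) ∧ ∀ j ∉ P, a j 1 = 0 := by
  constructor
  · rintro ⟨x, rfl⟩
    refine ⟨fun j => by rw [dirichletData_apply]; rfl, fun j hj => ?_⟩
    rw [dirichletData_apply]
    exact Function.extend_apply' _ _ _ fun ⟨k, hk⟩ => hj (hk ▸ k.2)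
  · rintro ⟨h0, h1⟩
    refine ⟨fun j => a j 1, ?_⟩
    ext j i
    rw [dirichletData_apply]
    fin_cases i
    · exact (h0 j).symm
    · by_cases hj : j ∈ P
      · exact Subtype.val_injective.extend_apply (fun j : P => a j 1) 0 ⟨j, hj⟩
      · have hrange : ¬ ∃ k : P, (k : ι) = j := fun ⟨k, hk⟩ => hj (hk ▸ k.2)
        exact (Function.extend_apply' (fun j : P => a j 1) (0 : ι → ℂ) j hrange).trans
          (h1 j hj).symm

theorem sum_dirichletData [Fintype ι] [Fintype P] (x : P → ℂ) :
    ∑ j, dirichletData P x j 1 = ∑ j, x j := by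
  simp only [dirichletData_apply, cons_val_one]
  refine (Fintype.sum_of_injective _ Subtype.val_injective _ _ (fun j hj => ?_) fun j => ?_).symm
  · exact Function.extend_apply' _ _ _ hj
  · exact (Subtype.val_injective.extend_apply _ _ _).symm

theorem finrank_fun_coe_set (P : Set ι) [Finite P] :
    (Module.finrank ℂ (P → ℂ) : ℕ∞) = P.encard := by
  have := Fintype.ofFinite P
  rw [Module.finrank_fintype_fun_eq_card, ← Nat.card_eq_fintype_card, Nat.card_coe_set_eq,
    P.toFinite.cast_ncard_eq]

end DirichletData

theorem mem_range_dirichletData_poles_iff :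
    a ∈ LinearMap.range (dirichletData {j | G.IsPole j z}) ↔
      (∀ j, a j 0 * G.b j z + a j 1 * G.c j z = 0) ∧ ∀ j, a j 0 = 0 := by
  rw [mem_range_dirichletData_iff, and_comm]
  refine and_congr_left fun h0 => forall_congr' fun j => ?_
  rw [mem_ofPred_eq, isPole_iff, h0, zero_mul, zero_add, mul_eq_zero, or_iff_not_imp_right]

theorem multiplicity_T_zero (z : ℂ) :
    (G.T 0).multiplicity z = {j | G.IsPole j z}.encard := by
  have hdata : G.vertexData 0 z = LinearMap.range (dirichletData {j | G.IsPole j z}) := by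
    ext a
    rw [mem_range_dirichletData_poles_iff, mem_vertexData_iff, robinCondition_zero_iff]
  rw [multiplicity_T, hdata, LinearMap.finrank_range_of_inj injective_dirichletData,
    finrank_fun_coe_set]

open Classical in
theorem vertexData_eq_map_ker_of_isPole (hτ : τ ≠ 0) {i : Fin n} (hi : G.IsPole i z) :
    G.vertexData τ z = (LinearMap.ker (∑ j, LinearMap.proj j)).map
      (dirichletData {j | G.IsPole j z}) := by
  ext a
  rw [mem_vertexData_iff, robinCondition_iff hτ i]
  simp only [Submodule.mem_map, LinearMap.mem_ker, LinearMap.sum_apply, LinearMap.proj_apply]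
  constructor
  · rintro ⟨houter, hcont, hsum⟩
    have hai : a i 0 = 0 := by
      have hci := isPole_iff.1 hi
      have h := houter i
      rw [hci, mul_zero, add_zero] at h
      exact (mul_eq_zero.1 h).resolve_right (b_ne_zero_of_c_eq_zero hci)
    obtain ⟨x, rfl⟩ := mem_range_dirichletData_poles_iff.2 ⟨houter, fun j => (hcont j).trans hai⟩
    rw [hai, mul_zero, sum_dirichletData] at hsum
    exact ⟨x, hsum.symm, rfl⟩
  · rintro ⟨x, hx, rfl⟩
    obtain ⟨houter, h0⟩ := mem_range_dirichletData_poles_iff.1 ⟨x, rfl⟩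
    refine ⟨houter, fun j => (h0 j).trans (h0 i).symm, ?_⟩
    rw [h0, mul_zero, sum_dirichletData, hx]

theorem multiplicity_T_of_isPole (hτ : τ ≠ 0) {i : Fin n} (hi : G.IsPole i z) :
    (G.T τ).multiplicity z = {j | G.IsPole j z}.encard - 1 := by
  classical
  have hsum : (∑ j, LinearMap.proj j : Module.Dual ℂ ({j | G.IsPole j z} → ℂ)) ≠ 0 := fun h => by
    simpa using LinearMap.congr_fun h (Pi.single ⟨i, hi⟩ 1)
  rw [multiplicity_T, vertexData_eq_map_ker_of_isPole hτ hi,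
    ← (Submodule.equivMapOfInjective _ injective_dirichletData _).finrank_eq,
    ← finrank_fun_coe_set, ← Module.Dual.finrank_ker_add_one_of_ne_zero hsum, Nat.cast_add,
    Nat.cast_one, (ENat.addLECancellable_of_ne_top ENat.one_ne_top).add_tsub_cancel_right]

theorem multiplicity_T_of_ncard_eq (hτ : τ ≠ 0) {ν : ℕ}
    (hν : {j | G.IsPole j z}.ncard = ν + 1) : (G.T τ).multiplicity z = ν := by
  obtain ⟨i, hi⟩ : {j | G.IsPole j z}.Nonempty := by
    rw [← ncard_pos, hν]
    exact ν.succ_pos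
  rw [multiplicity_T_of_isPole hτ hi, ← (toFinite {j | G.IsPole j z}).cast_ncard_eq, hν,
    Nat.cast_add, Nat.cast_one,
    (ENat.addLECancellable_of_ne_top ENat.one_ne_top).add_tsub_cancel_right]

theorem mem_vertexData_iff_of_forall_not_isPole [NeZero n] (hτ : τ ≠ 0)
    (hz : ∀ j, ¬ G.IsPole j z) : a ∈ G.vertexData τ z ↔
      ∃ x : ℂ, (∑ j, G.m j z + (τ⁻¹).toReal) * x = 0 ∧ (x • fun j => ![1, -G.m j z]) = a := by
  have hc j : G.c j z ≠ 0 := mt isPole_iff.2 (hz j)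
  rw [mem_vertexData_iff, robinCondition_iff hτ 0]
  constructor
  · rintro ⟨houter, hcont, hsum⟩
    have ha j : a j 1 = -(a 0 0 * G.m j z) := by
      rw [m, ← hcont j]
      field_simp [hc j]
      linear_combination houter j
    refine ⟨a 0 0, ?_, ?_⟩
    · simp only [ha, Finset.sum_neg_distrib, ← Finset.mul_sum] at hsum
      linear_combination hsum
    · ext j i
      fin_cases i
      · simp [hcont j]
      · simp [ha j]
  · rintro ⟨x, hx, rfl⟩
    simp only [Pi.smul_apply, smul_eq_mul, cons_val_zero, cons_val_one, mul_one]
    refine ⟨fun j => ?_, fun _ => trivial, ?_⟩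
    · rw [m]
      field_simp [hc j]
      ring
    · rw [← Finset.mul_sum, Finset.sum_neg_distrib]
      linear_combination hx

theorem IsWeylSolution.multiplicity_eq_one [NeZero n] (hτ : τ ≠ 0) (h : G.IsWeylSolution τ z) :
    (G.T τ).multiplicity z = 1 := by
  have hdata : G.vertexData τ z = Submodule.span ℂ {fun j => ![1, -G.m j z]} := by
    ext a
    simp only [mem_vertexData_iff_of_forall_not_isPole hτ h.1, h.2, neg_add_cancel, zero_mul,
      true_and, Submodule.mem_span_singleton]
  rw [multiplicity_T, hdata, finrank_span_singleton, Nat.cast_one]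
  exact fun h0 => one_ne_zero (congrFun (congrFun h0 0) 0)

theorem multiplicity_T_eq_zero [NeZero n] (hτ : τ ≠ 0) (hz : ∀ j, ¬ G.IsPole j z)
    (h : ¬ G.IsWeylSolution τ z) : (G.T τ).multiplicity z = 0 := by
  have hne : ∑ j, G.m j z + (τ⁻¹).toReal ≠ 0 := fun h0 => h ⟨hz, eq_neg_of_add_eq_zero_left h0⟩
  have hdata : G.vertexData τ z = ⊥ := by
    refine (Submodule.eq_bot_iff _).2 fun a ha => ?_
    obtain ⟨x, hx, rfl⟩ := (mem_vertexData_iff_of_forall_not_isPole hτ hz).1 ha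
    rw [(mul_eq_zero.1 hx).resolve_left hne, zero_smul]
  rw [multiplicity_T, hdata, finrank_bot, Nat.cast_zero]

end DiracStarGraph

namespace DiracStarGraph

section WeylLevel

open Filter Topology

/-- The right-hand side `-1/τ` of the equation `∑ m_j(z) = -1/τ`, with `1/(±∞) = 0`. -/
def weylLevel (τ : EReal) : ℝ := -(τ⁻¹).toReal

theorem weylLevel_eq (τ : EReal) : weylLevel τ = -τ.toReal⁻¹ := by
  rw [weylLevel]
  induction τ with
  | bot => simp
  | top => simp
  | coe r => rw [← EReal.coe_inv, EReal.toReal_coe, EReal.toReal_coe]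

theorem continuousAt_weylLevel {τ : EReal} (hτ : τ ≠ 0) : ContinuousAt weylLevel τ := by
  rw [funext weylLevel_eq]
  by_cases htop : τ = ⊤
  · subst htop
    rw [continuousAt_iff_punctured_nhds]
    simpa using (tendsto_inv_atTop_zero.comp EReal.tendsto_toReal_atTop).neg
  by_cases hbot : τ = ⊥
  · subst hbot
    rw [continuousAt_iff_punctured_nhds]
    simpa using (tendsto_inv_atBot_zero.comp EReal.tendsto_toReal_atBot).neg
  · exact ((EReal.tendsto_toReal htop hbot).inv₀
      (EReal.toReal_ne_zero_iff.2 ⟨hτ, htop, hbot⟩)).neg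

theorem strictMonoOn_weylLevel_Ioi : StrictMonoOn weylLevel (Ioi 0) := by
  intro σ hσ τ hτ hστ
  refine neg_lt_neg (EReal.coe_lt_coe_iff.1 ?_)
  rw [EReal.coe_toReal (EReal.inv_lt_top τ).ne (EReal.bot_lt_inv τ).ne',
    EReal.coe_toReal (EReal.inv_lt_top σ).ne (EReal.bot_lt_inv σ).ne']
  exact EReal.inv_strictAntiOn hσ hτ hστ

theorem weylLevel_neg (τ : EReal) : weylLevel (-τ) = -weylLevel τ := by
  rw [weylLevel, weylLevel, EReal.inv_neg, EReal.toReal_neg_eq]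

theorem strictMonoOn_weylLevel_Iio : StrictMonoOn weylLevel (Iio 0) := by
  intro σ hσ τ hτ hστ
  have h := strictMonoOn_weylLevel_Ioi (EReal.neg_pos.2 hτ) (EReal.neg_pos.2 hσ)
    (EReal.neg_lt_neg_iff.2 hστ)
  rwa [weylLevel_neg, weylLevel_neg, neg_lt_neg_iff] at h

end WeylLevel

end DiracStarGraph

section Enumeration

variable {E : Type*} [AddCommGroup E] [Module ℂ E] {A : E →ₗ.[ℂ] E} {a : ℤ → ℝ}

theorem isEigenvalueEnumeration_shift (h : A.IsEigenvalueEnumeration a) :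
    A.IsEigenvalueEnumeration fun k => a (k + 1) := by
  refine ⟨fun k l hkl => h.1 (by omega), fun z => ?_⟩
  rw [← h.2 z]
  exact encard_congr ((Equiv.addRight (1 : ℤ)).subtypeEquiv fun _ => Iff.rfl)

theorem isEigenvalueEnumeration_of_real (ha : Monotone a)
    (hreal : ∀ x : ℝ, {k | a k = x}.encard = A.multiplicity x)
    (hnonreal : ∀ z : ℂ, z.im ≠ 0 → A.multiplicity z = 0) : A.IsEigenvalueEnumeration a := by
  refine ⟨ha, fun z => ?_⟩
  by_cases hz : z.im = 0
  · lift z to ℝ using hz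
    simpa only [Complex.ofReal_inj] using hreal z
  · rw [hnonreal z hz, encard_eq_zero]
    exact eq_empty_of_forall_notMem fun k hk => hz (hk ▸ Complex.ofReal_im _)

end Enumeration

namespace DiracStarGraph

variable {n : ℕ} [NeZero n] (G : DiracStarGraph n)

/-- The restriction of `∑ m_j` to the real axis. -/
def weylSum (x : ℝ) : ℝ := ∑ j, G.mReal j x

theorem exists_isPoleEnumeration : ∃ D, IsPoleEnumeration G.weylSum D ∧
    ∀ x : ℝ, {k | D k = x}.encard = {j | G.IsPole j x}.encard := by
  have hsub (j : Fin n) := subset_iUnion (fun j => {x : ℝ | G.c j x = 0}) j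
  have habove := mt (BddAbove.mono (hsub 0)) (G.not_bddAbove_setOf_c_eq_zero 0)
  have hbelow := mt (BddBelow.mono (hsub 0)) (G.not_bddBelow_setOf_c_eq_zero 0)
  obtain ⟨D, hD, hcard⟩ := exists_monotone_encard_eq
    (fun j => G.finite_setOf_c_eq_zero_inter_Icc j) habove hbelow
  have hrange : range D = ⋃ j, {x : ℝ | G.c j x = 0} := by
    ext x
    have h := congrArg (· ≠ 0) (hcard x)
    simp only [ne_eq, encard_ne_zero, eq_iff_iff] at h
    rw [mem_iUnion]
    exact h
  refine ⟨D, ⟨hD, hrange ▸ habove, hrange ▸ hbelow, ?_⟩, fun x => ?_⟩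
  · rw [hrange]
    have h := IsIncreasingOffPoles.sum Finset.univ_nonempty
      fun j _ => G.isIncreasingOffPoles_mReal j
    simp only [Finset.mem_univ, iUnion_true] at h
    exact h
  · simpa only [isPole_iff, mem_ofPred_eq] using hcard x

/-- The poles of `m_1, …, m_n`, which are real, in nondecreasing order; a common pole of `ν` of
these functions is listed `ν` times. -/
def poleSeq : ℤ → ℝ := Classical.choose G.exists_isPoleEnumeration

theorem isPoleEnumeration_poleSeq : IsPoleEnumeration G.weylSum G.poleSeq :=
  (Classical.choose_spec G.exists_isPoleEnumeration).1

theorem encard_poleSeq_eq (x : ℝ) :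
    {k | G.poleSeq k = x}.encard = {j | G.IsPole j x}.encard :=
  (Classical.choose_spec G.exists_isPoleEnumeration).2 x

theorem mem_range_poleSeq_iff {x : ℝ} : x ∈ range G.poleSeq ↔ ∃ j, G.IsPole j x := by
  have h := congrArg (· ≠ 0) (G.encard_poleSeq_eq x)
  simp only [ne_eq, encard_ne_zero, eq_iff_iff] at h
  exact h

/-- The eigenvalues of `T_τ`, `τ ≠ 0`: the solution of `∑ m_j(x) = -1/τ` in the `k`-th gap between
consecutive poles if the gap is nonempty, and the pole itself otherwise. -/
def branch (τ : EReal) : ℤ → ℝ := levelBranch G.weylSum G.poleSeq (weylLevel τ)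

variable {G} {τ : EReal}

theorem isWeylSolution_ofReal_iff {x : ℝ} : G.IsWeylSolution τ x ↔
    x ∉ range G.poleSeq ∧ G.weylSum x = weylLevel τ := by
  rw [IsWeylSolution, mem_range_poleSeq_iff, not_exists, weylSum, weylLevel]
  simp only [← ofReal_mReal]
  norm_cast

theorem IsWeylSolution.im_eq_zero {z : ℂ} (h : G.IsWeylSolution τ z) : z.im = 0 := by
  by_contra hz
  have hpos : 0 < ∑ j, z.im * (G.m j z).im :=
    Finset.sum_pos (fun j _ => im_mul_im_m_pos hz) Finset.univ_nonempty
  rw [← Finset.mul_sum, ← Complex.im_sum, h.2, ← Complex.ofReal_neg, Complex.ofReal_im,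
    mul_zero] at hpos
  exact hpos.false

theorem multiplicity_T_eq_zero_of_im_ne_zero (τ : EReal) {z : ℂ} (hz : z.im ≠ 0) :
    (G.T τ).multiplicity z = 0 := by
  have hpole (j : Fin n) : ¬ G.IsPole j z :=
    fun hj => hz (im_eq_zero_of_c_eq_zero (isPole_iff.1 hj))
  by_cases hτ : τ = 0
  · rw [hτ, multiplicity_T_zero, encard_eq_zero]
    exact eq_empty_of_forall_notMem hpole
  · exact multiplicity_T_eq_zero hτ hpole fun h => hz h.im_eq_zero

theorem isEigenvalueEnumeration_poleSeq : (G.T 0).IsEigenvalueEnumeration G.poleSeq :=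
  isEigenvalueEnumeration_of_real G.isPoleEnumeration_poleSeq.monotone
    (fun x => (G.encard_poleSeq_eq x).trans (multiplicity_T_zero _).symm)
    fun _ => multiplicity_T_eq_zero_of_im_ne_zero 0

theorem isEigenvalueEnumeration_branch (hτ : τ ≠ 0) :
    (G.T τ).IsEigenvalueEnumeration (G.branch τ) := by
  have hpoles := G.isPoleEnumeration_poleSeq
  refine isEigenvalueEnumeration_of_real (hpoles.monotone_levelBranch _) (fun x => ?_)
    fun _ => multiplicity_T_eq_zero_of_im_ne_zero τ
  by_cases hx : x ∈ range G.poleSeq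
  · obtain ⟨j, hj⟩ := G.mem_range_poleSeq_iff.1 hx
    rw [branch, hpoles.encard_levelBranch_eq_of_mem_range _ hx, encard_poleSeq_eq,
      multiplicity_T_of_isPole hτ hj]
  · rw [branch, hpoles.encard_levelBranch_eq_of_notMem_range hx]
    split_ifs with hsol
    · exact (IsWeylSolution.multiplicity_eq_one hτ (isWeylSolution_ofReal_iff.2 ⟨hx, hsol⟩)).symm
    · exact (multiplicity_T_eq_zero hτ (fun j hj => hx (G.mem_range_poleSeq_iff.2 ⟨j, hj⟩))
        fun h => hsol (isWeylSolution_ofReal_iff.1 h).2).symm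

theorem poleSeq_le_branch (τ : EReal) (k : ℤ) : G.poleSeq k ≤ G.branch τ k :=
  (G.isPoleEnumeration_poleSeq.levelBranch_mem_Icc _ k).1

theorem branch_le_poleSeq (τ : EReal) (k : ℤ) : G.branch τ k ≤ G.poleSeq (k + 1) :=
  (G.isPoleEnumeration_poleSeq.levelBranch_mem_Icc _ k).2

theorem branch_le_branch {σ : EReal} (h : weylLevel σ ≤ weylLevel τ) (k : ℤ) :
    G.branch σ k ≤ G.branch τ k :=
  G.isPoleEnumeration_poleSeq.levelBranch_mono k h

theorem eigenvaluesInterlace (τ₁ τ₂ : EReal) : (G.T τ₁).EigenvaluesInterlace (G.T τ₂) := by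
  have hpoles := isEigenvalueEnumeration_poleSeq (G := G)
  rcases eq_or_ne τ₁ 0 with rfl | h₁ <;> rcases eq_or_ne τ₂ 0 with rfl | h₂
  · exact ⟨_, _, hpoles, hpoles, fun k =>
      ⟨le_rfl, G.isPoleEnumeration_poleSeq.le_succ k⟩⟩
  · exact ⟨_, _, hpoles, isEigenvalueEnumeration_branch h₂, fun k =>
      ⟨poleSeq_le_branch τ₂ k, branch_le_poleSeq τ₂ k⟩⟩
  · exact ⟨_, _, isEigenvalueEnumeration_branch h₁, isEigenvalueEnumeration_shift hpoles, fun k =>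
      ⟨branch_le_poleSeq τ₁ k, poleSeq_le_branch τ₁ (k + 1)⟩⟩
  have hb₁ := isEigenvalueEnumeration_branch (G := G) h₁
  have hb₂ := isEigenvalueEnumeration_branch (G := G) h₂
  rcases le_total (weylLevel τ₁) (weylLevel τ₂) with h | h
  · exact ⟨_, _, hb₁, hb₂, fun k =>
      ⟨branch_le_branch h k, (branch_le_poleSeq τ₂ k).trans (poleSeq_le_branch τ₁ (k + 1))⟩⟩
  · exact ⟨_, _, hb₁, isEigenvalueEnumeration_shift hb₂, fun k =>
      ⟨(branch_le_poleSeq τ₁ k).trans (poleSeq_le_branch τ₂ (k + 1)), branch_le_branch h (k + 1)⟩⟩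

theorem isEigenvalue_iff (hτ : τ ≠ 0) (z : ℂ) :
    (G.T τ).IsEigenvalue z ↔ G.IsWeylSolution τ z ∨ 2 ≤ {j | G.IsPole j z}.ncard := by
  rw [isEigenvalue_iff_multiplicity_ne_zero]
  rcases {j | G.IsPole j z}.eq_empty_or_nonempty with hempty | ⟨i, hi⟩
  · rw [hempty, ncard_empty, or_iff_left (by omega)]
    refine ⟨fun h => ?_, fun h => (h.multiplicity_eq_one hτ).trans_ne one_ne_zero⟩
    by_contra hsol
    exact h (multiplicity_T_eq_zero hτ (eq_empty_iff_forall_notMem.1 hempty) hsol)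
  · rw [multiplicity_T_of_isPole hτ hi, ← (toFinite {j | G.IsPole j z}).cast_ncard_eq,
      or_iff_right fun h => h.1 i hi, ← Nat.cast_one, ← ENat.natCast_sub, Nat.cast_ne_zero]
    omega

theorem exists_unique_branch {I : Set EReal} (hconn : IsPreconnected I) (hne : ∀ τ ∈ I, τ ≠ 0)
    (hmono : StrictMonoOn weylLevel I) {τ₀ : EReal} (hτ₀ : τ₀ ∈ I) {z₀ : ℂ}
    (hz₀ : G.IsWeylSolution τ₀ z₀) :
    ∃ lam : EReal → ℝ, (lam τ₀ : ℂ) = z₀ ∧ ContinuousOn lam I ∧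
      (∀ τ ∈ I, G.IsWeylSolution τ (lam τ)) ∧ StrictMonoOn lam I ∧
      ∀ mu : EReal → ℝ, (mu τ₀ : ℂ) = z₀ → ContinuousOn mu I →
        (∀ τ ∈ I, G.IsWeylSolution τ (mu τ)) → EqOn mu lam I := by
  have hpoles := G.isPoleEnumeration_poleSeq
  lift z₀ to ℝ using hz₀.im_eq_zero
  obtain ⟨hnotMem, hval⟩ := isWeylSolution_ofReal_iff.1 hz₀
  obtain ⟨k, hk⟩ := hpoles.exists_mem_gap hnotMem
  have hgap : G.poleSeq k < G.poleSeq (k + 1) := hk.1.trans hk.2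
  refine ⟨fun τ => G.branch τ k, congrArg _ ((hpoles.levelBranch_eq_iff hk).2 hval),
    fun τ hτ => ?_, fun τ _ => isWeylSolution_ofReal_iff.2 ⟨?_, ?_⟩, fun σ hσ τ hτ hστ => ?_,
    fun mu hmu₀ hmu hsol τ hτ => ?_⟩
  · exact ((hpoles.continuous_levelBranch hgap).continuousAt.comp
      (continuousAt_weylLevel (hne τ hτ))).continuousWithinAt
  · exact mt hpoles.levelBranch_mem_range_iff.1 hgap.ne
  · exact (hpoles.levelBranch_mem_gap _ hgap).2
  · exact hpoles.strictMono_levelBranch hgap (hmono hσ hτ hστ)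
  · have hsol' σ (hσ : σ ∈ I) := isWeylSolution_ofReal_iff.1 (hsol σ hσ)
    change mu τ = levelBranch G.weylSum G.poleSeq (weylLevel τ) k
    rw [← (hsol' τ hτ).2]
    exact hpoles.eq_levelBranch_of_continuousOn hconn hmu (fun σ hσ => (hsol' σ hσ).1) hτ₀
      (Complex.ofReal_injective hmu₀ ▸ hk) hτ

end DiracStarGraph

end

theorem theorem5p3 {n : ℕ} (hn : 1 ≤ n) (G : DiracStarGraph n) :
    -- the eigenvalues of `T_τ` are of two types
    (∀ τ : EReal, τ ≠ 0 → ∀ z : ℂ,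
      (G.T τ).IsEigenvalue z ↔ G.IsWeylSolution τ z ∨ 2 ≤ {j | G.IsPole j z}.ncard) ∧
    -- type i): simplicity
    (∀ τ : EReal, τ ≠ 0 → ∀ z : ℂ, G.IsWeylSolution τ z → (G.T τ).multiplicity z = 1) ∧
    -- type i): each solution is a strictly increasing function of `τ` on `[-∞, 0)` and `(0, ∞]`
    (∀ I : Set EReal, I = Set.Ico ⊥ 0 ∨ I = Set.Ioc 0 ⊤ →
      ∀ τ₀ ∈ I, ∀ z₀ : ℂ, G.IsWeylSolution τ₀ z₀ →
        ∃ lam : EReal → ℝ,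
          (lam τ₀ : ℂ) = z₀ ∧ ContinuousOn lam I ∧ (∀ τ ∈ I, G.IsWeylSolution τ (lam τ)) ∧
          StrictMonoOn lam I ∧
          ∀ mu : EReal → ℝ, (mu τ₀ : ℂ) = z₀ → ContinuousOn mu I →
            (∀ τ ∈ I, G.IsWeylSolution τ (mu τ)) → Set.EqOn mu lam I) ∧
    -- type ii): common poles of exactly `ν + 1` of the `m_j`; no dependence on `τ`
    (∀ z : ℂ, ∀ ν : ℕ, 1 ≤ ν → {j | G.IsPole j z}.ncard = ν + 1 →
      ∀ τ : EReal, τ ≠ 0 → (G.T τ).multiplicity z = ν) ∧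
    -- interlacing
    (∀ τ₁ τ₂ : EReal, (G.T τ₁).EigenvaluesInterlace (G.T τ₂)) := by
  have : NeZero n := ⟨by omega⟩
  refine ⟨fun τ hτ z => DiracStarGraph.isEigenvalue_iff hτ z,
    fun τ hτ z hz => hz.multiplicity_eq_one hτ, fun I hI τ₀ hτ₀ z₀ hz₀ => ?_,
    fun z ν _ hz τ hτ => DiracStarGraph.multiplicity_T_of_ncard_eq hτ hz,
    DiracStarGraph.eigenvaluesInterlace⟩
  rcases hI with rfl | rfl
  · exact DiracStarGraph.exists_unique_branch isPreconnected_Ico (fun τ hτ => hτ.2.ne)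
      (DiracStarGraph.strictMonoOn_weylLevel_Iio.mono fun τ hτ => hτ.2) hτ₀ hz₀
  · exact DiracStarGraph.exists_unique_branch isPreconnected_Ioc (fun τ hτ => hτ.1.ne')
      (DiracStarGraph.strictMonoOn_weylLevel_Ioi.mono fun τ hτ => hτ.1) hτ₀ hz₀
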